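/- Let $\mathrm{Sh}$ be the Shrikhande graph, i.e. the graph on $\mathbb{Z}_4^2$ in which two vertices are adjacent if and only if their difference is one of $\pm(1,0),\pm(0,1),\pm(1,1)$, let $K_4$ be the complete graph on $4$ vertices, and for integers $m,n\ge 0$ let $D(m,n)=\mathrm{Sh}^m\times K_4^n$ be the Cartesian product of $m$ copies of $\mathrm{Sh}$ and $n$ copies of $K_4$ (a Doob graph if $m>0$, and the Hamming graph $H(n,4)$ if $m=0$). An MDS code in $D(m,n)$ is a maximum independent set of $D(m,n)$, i.e. an independent set of the largest possible cardinality. Then the number of MDS codes in $D(m,n)$ does not exceed $$2^{2^{2m+n-1}(1+o(1))}\qquad\text{as } 2m+n\to\infty;$$ that is, there is a function $\varepsilon:\mathbb{N}\to\mathbb{R}$ with $\varepsilon(N)\to 0$ as $N\to\infty$ such that for all $m,n\ge 0$ the number of MDS codes in $D(m,n)$ is at most $2^{2^{2m+n-1}(1+\varepsilon(2m+n))}$. -/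

import Mathlib

open Filter Topology

/-- The Shrikhande graph: vertex set `ℤ₄ × ℤ₄`, two vertices being adjacent iff their difference
is one of `±(1,0)`, `±(0,1)`, `±(1,1)`. -/
def shrikhande : SimpleGraph (ZMod 4 × ZMod 4) :=
  SimpleGraph.circulantGraph {(1, 0), (0, 1), (1, 1)}

/-- The Cartesian power `G^k`: two tuples are adjacent iff they are adjacent (in `G`) in exactly
one coordinate and coincide in all the other coordinates. -/
def cartesianPower {V : Type*} (G : SimpleGraph V) (k : ℕ) : SimpleGraph (Fin k → V) where
  Adj x y := ∃ i, G.Adj (x i) (y i) ∧ ∀ j, j ≠ i → x j = y j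
  symm := ⟨fun _ _ ⟨i, h, h'⟩ => ⟨i, h.symm, fun j hj => (h' j hj).symm⟩⟩
  loopless := ⟨fun _ ⟨_, h, _⟩ => h.ne rfl⟩

/-- The vertices of `D(m,n)`. -/
abbrev DoobVertex (m n : ℕ) : Type :=
  (Fin m → ZMod 4 × ZMod 4) × (Fin n → Fin 4)

/-- The graph `D(m,n) = Sh^m × K₄^n` (Cartesian product of graphs). It is a Doob graph if
`0 < m`, and the Hamming graph `H(n,4)` if `m = 0`. -/
def doobGraph (m n : ℕ) : SimpleGraph (DoobVertex m n) :=
  (cartesianPower shrikhande m).boxProd (cartesianPower (⊤ : SimpleGraph (Fin 4)) n)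

/-- The set of (distance-2) MDS codes in `D(m,n)`, i.e. of its maximum independent sets. -/
def MDS (m n : ℕ) : Set (Finset (DoobVertex m n)) :=
  {M | (doobGraph m n).IsMaximumIndepSet M}

/-!
An MDS code of `D(m, n)` has four vertices on every Shrikhande fibre and one on every line, so any
two codes that are disjoint have a union which is balanced on all fibres, and two balanced
colourings that agree on a nonempty union of monochromatic components are equal. Propagating along
components in this way shows that, after each Shrikhande coordinate has been turned by one of three
automorphisms, every fibre of the code lies in two opposite rows. Such a code splits into `2 ^ m`
MDS codes of `H(m + n, 4)`, that is, Latin hypercubes of dimension `m + n - 1`. With `L(d)` the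
number of Latin hypercubes of dimension `d` this gives at most `3 ^ m * L(m + n - 1) ^ (2 ^ m)`
codes, and `2 ^ (m + n - 1) * 2 ^ m = 2 ^ (2 * m + n - 1)`.

It remains to see that `L(d) ≤ 2 ^ ((1 + o(1)) * 2 ^ d)`. A Latin hypercube known for two letters of
one coordinate is known up to one bit for each component of a link graph. Halving one coordinate
after the other in this way leaves a proper 4-colouring of the cube, and Finner's inequality shows
that there are `2 ^ ((1 + o(1)) * 2 ^ d)` of these. For random pairs of letters the expected number
of components decays by a factor `5 / 6` with each step, so that the loss is negligible if the
first few link graphs have `o(2 ^ d)` components. If one of them has more, then it comes from a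
two-colouring with a small component; there are few such colourings, and fewer than
`2 ^ (C * 2 ^ d)` hypercubes result when `L(d) ≤ 2 ^ ((C + o(1)) * 2 ^ d)` is known for a `C > 1`.
Hence the least admissible `C` is `1`.
-/

open Function

section Components

variable {V W : Type*} (G : SimpleGraph V)

/-- The number of connected components of the subgraph of `G` induced on `s`. -/
noncomputable def compCount (s : Set V) : ℕ :=
  Nat.card (G.induce s).ConnectedComponent

lemma compCount_image_le [Finite W] {H : SimpleGraph W} (f : H →g G) (s : Set W) :
    compCount G (f '' s) ≤ compCount H s := by
  let F : H.induce s →g G.induce (f '' s) :=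
    ⟨fun x => ⟨f x, Set.mem_image_of_mem f x.2⟩, fun h => f.map_adj h⟩
  refine Nat.card_le_card_of_surjective (SimpleGraph.ConnectedComponent.map F) fun c => ?_
  obtain ⟨⟨_, x, hx, rfl⟩, rfl⟩ := c.exists_rep
  exact ⟨(H.induce s).connectedComponentMk ⟨x, hx⟩, rfl⟩

/-- The vertices, seen in the ambient graph, of a component of an induced subgraph. -/
def compSet {G : SimpleGraph V} {s : Set V} (c : (G.induce s).ConnectedComponent) : Set V :=
  Subtype.val '' c.supp

variable {G}

lemma compSet_nonempty {s : Set V} (c : (G.induce s).ConnectedComponent) :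
    (compSet c).Nonempty :=
  c.nonempty_supp.image _

lemma mem_compSet_of_adj {s : Set V} {c : (G.induce s).ConnectedComponent} {x y : V}
    (hx : x ∈ compSet c) (hy : y ∈ s) (h : G.Adj x y) : y ∈ compSet c := by
  obtain ⟨x, rfl, rfl⟩ := hx
  have hyx : (G.induce s).Adj ⟨y, hy⟩ x := h.symm
  exact ⟨⟨y, hy⟩, SimpleGraph.ConnectedComponent.sound hyx.reachable, rfl⟩

lemma exists_compCount_mul_ncard_le [Finite V] {s : Set V} (hs : s.Nonempty) :
    ∃ c : (G.induce s).ConnectedComponent, compCount G s * (compSet c).ncard ≤ s.ncard := by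
  classical
  have := hs.to_subtype
  have := Fintype.ofFinite s
  have := Fintype.ofFinite (G.induce s).ConnectedComponent
  obtain ⟨c, hc⟩ := Finite.exists_min fun c : (G.induce s).ConnectedComponent => c.supp.ncard
  have hfib : ∀ c', c.supp.ncard ≤
      (Finset.univ.filter fun x => (G.induce s).connectedComponentMk x = c').card := fun c' => by
    rw [← Set.ncard_coe_finset, Finset.coe_filter_univ]
    exact hc c'
  refine ⟨c, ?_⟩
  rw [compSet, Set.ncard_image_of_injective _ Subtype.val_injective, compCount, mul_comm,
    ← Nat.card_coe_set_eq s, Nat.card_eq_fintype_card, Nat.card_eq_fintype_card]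
  exact Finset.mul_card_image_le_card_of_maps_to (fun x _ => Finset.mem_univ _) _
    fun c' _ => hfib c'

lemma two_mul_card_le_of_surjective {D E : Type*} [Finite D] {p : D → E} (hp : Surjective p) :
    2 * Nat.card E ≤ Nat.card D + Nat.card {z // ∀ z', p z' = p z → z' = z} := by
  classical
  obtain ⟨s, hs⟩ := hp.hasRightInverse
  have := Finite.of_surjective p hp
  have hother : ∀ e, (∃ z, p z = e ∧ z ≠ s e) ∨ ∀ z', p z' = p (s e) → z' = s e := fun e => by
    rw [hs e]
    by_contra! h
    obtain ⟨h, z, hz, hne⟩ := h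
    exact hne (h z hz)
  have : ∃ F : E → D ⊕ {z // ∀ z', p z' = p z → z' = z}, ∀ e,
      (Sum.elim p (p ∘ Subtype.val) (F e) = e) ∧ F e ≠ Sum.inl (s e) := by
    refine ⟨fun e => if h : ∃ z, p z = e ∧ z ≠ s e then .inl h.choose
      else .inr ⟨s e, (hother e).resolve_left h⟩, fun e => ?_⟩
    dsimp only
    split_ifs with h
    · exact ⟨h.choose_spec.1, fun h' => h.choose_spec.2 (Sum.inl_injective h')⟩
    · exact ⟨hs e, Sum.inr_ne_inl⟩
  obtain ⟨F, hF⟩ := this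
  rw [two_mul, ← Nat.card_sum, ← Nat.card_sum]
  refine Nat.card_le_card_of_injective (Sum.elim (Sum.inl ∘ s) F) ?_
  refine (Sum.inl_injective.comp hs.injective).sumElim ?_ ?_
  · intro e e' h
    rw [← (hF e).1, h, (hF e').1]
  · intro e e' h
    have := (hF e').1
    rw [← h] at this
    obtain rfl : e = e' := (hs e).symm.trans this
    exact (hF e).2 h.symm

end Components

section RandomBoxes

/-- The words of length `d` over a four-letter alphabet. -/
abbrev Word (d : ℕ) : Type := Fin d → Fin 4

/-- The word `y` preceded by the letter `a`. -/
abbrev prepend {d : ℕ} (a : Fin 4) (y : Word d) : Word (d + 1) := Fin.cons a y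

lemma exists_prepend_eq {d : ℕ} (z : Word (d + 1)) : ∃ a y, prepend a y = z :=
  ⟨z 0, Fin.tail z, Fin.cons_self_tail z⟩

lemma prepend_injective {d : ℕ} (a : Fin 4) : Injective (prepend (d := d) a) :=
  Fin.cons_right_injective (α := fun _ => Fin 4) a

/-- The two-element sets of letters. -/
abbrev Pair : Type := {P : Finset (Fin 4) // P.card = 2}

/-- The words whose first `t` letters lie in prescribed pairs. -/
def box {d : ℕ} (Q : Fin d → Pair) (t : ℕ) : Set (Word d) :=
  {y | ∀ i : Fin d, (i : ℕ) < t → y i ∈ (Q i).1}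

/-- Every vertex is adjacent to another word in each of the `d` directions. -/
def HasPartners {d : ℕ} (G : SimpleGraph (Word d)) : Prop :=
  ∀ y i, ∃ c, c ≠ y i ∧ G.Adj y (update y i c)

/-- The components of the parts of a family of vertex sets. -/
abbrev PartComponent {V ι : Type*} (G : SimpleGraph V) (R : ι → Set V) : Type _ :=
  Σ a, (G.induce (R a)).ConnectedComponent

lemma two_mul_compCount_biUnion_le {V ι : Type*} [Finite V] [Finite ι] {G : SimpleGraph V}
    {R : ι → Set V} {b : PartComponent G R → ι} (hb : ∀ z, b z ≠ z.1)
    (hadj : ∀ z, ∃ x ∈ compSet z.2, ∃ y ∈ R (b z), G.Adj x y) (P : Finset ι) :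
    2 * compCount G (⋃ a ∈ P, R a) ≤ Nat.card {z : PartComponent G R // z.1 ∈ P} +
      Nat.card {z : PartComponent G R // z.1 ∈ P ∧ b z ∉ P} := by
  have hsub : ∀ a ∈ P, R a ⊆ ⋃ a ∈ P, R a := fun a ha => Set.subset_biUnion_of_mem ha
  let p : {z : PartComponent G R // z.1 ∈ P} → (G.induce (⋃ a ∈ P, R a)).ConnectedComponent :=
    fun z => z.1.2.map (SimpleGraph.induceHomOfLE G (hsub _ z.2)).toHom
  have hp : Surjective p := fun c => by
    obtain ⟨⟨x, hx⟩, rfl⟩ := c.exists_rep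
    obtain ⟨a, ha, hxa⟩ := Set.mem_iUnion₂.1 hx
    exact ⟨⟨⟨a, (G.induce (R a)).connectedComponentMk ⟨x, hxa⟩⟩, ha⟩, rfl⟩
  have hlonely : ∀ z, (∀ z', p z' = p z → z' = z) → b z.1 ∉ P := by
    rintro ⟨z, hz⟩ h hbP
    obtain ⟨_, ⟨x, hx, rfl⟩, y, hy, hxy⟩ := hadj z
    refine hb z (congrArg (fun z => z.1.1)
      (h ⟨⟨_, (G.induce _).connectedComponentMk ⟨y, hy⟩⟩, hbP⟩ ?_))
    rw [SimpleGraph.ConnectedComponent.mem_supp_iff] at hx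
    simp only [p, ← hx]
    have : (G.induce (⋃ a ∈ P, R a)).Adj ⟨y, hsub _ hbP hy⟩ ⟨x, hsub _ hz x.2⟩ := hxy.symm
    exact SimpleGraph.ConnectedComponent.sound this.reachable
  refine (two_mul_card_le_of_surjective hp).trans (Nat.add_le_add_left ?_ _)
  refine Nat.card_le_card_of_injective
    (fun z => ⟨z.1.1, z.1.2, hlonely z.1 z.2⟩) fun z z' h => ?_
  exact Subtype.ext (Subtype.ext (Subtype.mk.inj h))

lemma sum_compCount_biUnion_le {V : Type*} [Finite V] (G : SimpleGraph V) (R : Fin 4 → Set V)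
    (hR : ∀ a, ∀ x ∈ R a, ∃ b, b ≠ a ∧ ∃ y ∈ R b, G.Adj x y) :
    2 * ∑ P : Pair, compCount G (⋃ a ∈ P.1, R a) ≤ 5 * ∑ a, compCount G (R a) := by
  classical
  have := Fintype.ofFinite (PartComponent G R)
  have hnb : ∀ z : PartComponent G R, ∃ b, b ≠ z.1 ∧ ∃ x ∈ compSet z.2, ∃ y ∈ R b, G.Adj x y := by
    rintro ⟨a, c⟩
    obtain ⟨x, hx⟩ := c.nonempty_supp
    obtain ⟨b, hb, y, hy, hxy⟩ := hR a x x.2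
    exact ⟨b, hb, x, ⟨x, hx, rfl⟩, y, hy, hxy⟩
  choose b hb hadj using hnb
  have hcount : ∀ a b : Fin 4, b ≠ a → ∑ P : Pair,
      ((if a ∈ P.1 then 1 else 0) + if a ∈ P.1 ∧ b ∉ P.1 then 1 else 0) = 5 := by
    decide
  calc 2 * ∑ P : Pair, compCount G (⋃ a ∈ P.1, R a)
      ≤ ∑ P : Pair, ∑ z : PartComponent G R,
          ((if z.1 ∈ P.1 then 1 else 0) + if z.1 ∈ P.1 ∧ b z ∉ P.1 then 1 else 0) := by
        rw [Finset.mul_sum]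
        refine Finset.sum_le_sum fun P _ => ?_
        simpa only [Nat.card_eq_fintype_card, Fintype.card_subtype, Finset.card_filter,
          Finset.sum_add_distrib] using two_mul_compCount_biUnion_le hb hadj P.1
    _ = ∑ z : PartComponent G R, 5 := by
        rw [Finset.sum_comm]
        exact Finset.sum_congr rfl fun z _ => hcount z.1 (b z) (hb z)
    _ = 5 * ∑ a, compCount G (R a) := by
        simp only [Finset.sum_const, Finset.card_univ, smul_eq_mul, mul_comm, compCount,
          ← Nat.card_eq_fintype_card, Nat.card_sigma]

lemma two_pow_le_ncard {d : ℕ} {K : Set (Word d)} (hK : K.Nonempty)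
    (h : ∀ y ∈ K, ∀ i, ∃ c, c ≠ y i ∧ update y i c ∈ K) : 2 ^ d ≤ K.ncard := by
  induction d with
  | zero => simpa [Nat.one_le_iff_ne_zero, Set.ncard_eq_zero (Set.toFinite K)] using hK.ne_empty
  | succ d ih =>
    have hslice : ∀ z ∈ K, 2 ^ d ≤ (prepend (z 0) ⁻¹' K).ncard :=
      fun z hz => ih ⟨Fin.tail z, by simpa using hz⟩ fun x hx i => by
        obtain ⟨c, hc, hcK⟩ := h _ hx i.succ
        exact ⟨c, by simpa using hc, by simpa using hcK⟩
    obtain ⟨z, hz⟩ := hK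
    obtain ⟨c, hc, hcK⟩ := h z hz 0
    have hcslice := hslice _ hcK
    rw [update_self] at hcslice
    have hdisj : Disjoint (prepend (z 0) '' (prepend (z 0) ⁻¹' K))
        (prepend c '' (prepend c ⁻¹' K)) := by
      refine Set.disjoint_left.2 ?_
      rintro _ ⟨x, -, rfl⟩ ⟨y, -, hy⟩
      exact hc (by simpa using congrFun hy 0)
    calc 2 ^ (d + 1) = 2 ^ d + 2 ^ d := by ring
      _ ≤ _ := Nat.add_le_add (hslice z hz) hcslice
      _ = _ := by
        rw [Set.ncard_union_eq hdisj, Set.ncard_image_of_injective _ (prepend_injective _),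
          Set.ncard_image_of_injective _ (prepend_injective _)]
      _ ≤ K.ncard := Set.ncard_le_ncard
        (Set.union_subset (Set.image_preimage_subset _ _) (Set.image_preimage_subset _ _))

lemma HasPartners.compCount_le {d : ℕ} {G : SimpleGraph (Word d)} (hG : HasPartners G) :
    compCount G Set.univ ≤ 2 ^ d := by
  obtain ⟨c, hc⟩ := exists_compCount_mul_ncard_le (G := G) Set.univ_nonempty
  have hK : 2 ^ d ≤ (compSet c).ncard := two_pow_le_ncard (compSet_nonempty c) fun y hy i => by
    obtain ⟨a, ha, hadj⟩ := hG y i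
    exact ⟨a, ha, mem_compSet_of_adj hy (Set.mem_univ _) hadj⟩
  have hcard : (Set.univ : Set (Word d)).ncard = 2 ^ d * 2 ^ d := by
    simp [Set.ncard_univ, ← mul_pow]
  refine Nat.le_of_mul_le_mul_right ?_ (Nat.two_pow_pos d)
  exact (Nat.mul_le_mul_left _ hK).trans (hc.trans hcard.le)

lemma HasPartners.comap_cons {d : ℕ} {G : SimpleGraph (Word (d + 1))} (hG : HasPartners G)
    (a : Fin 4) : HasPartners (G.comap (prepend a)) := fun y i => by
  obtain ⟨c, hc, hadj⟩ := hG (prepend a y) i.succ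
  exact ⟨c, by simpa using hc, by simpa using hadj⟩

lemma box_zero {d : ℕ} (Q : Fin d → Pair) : box Q 0 = Set.univ := by
  simp [box]

lemma box_cons {d : ℕ} (P : Pair) (Q : Fin d → Pair) (t : ℕ) :
    box (Fin.cons P Q : Fin (d + 1) → Pair) (t + 1) =
      ⋃ a ∈ P.1, prepend a '' box Q t := by
  ext z
  obtain ⟨a, y, rfl⟩ := exists_prepend_eq z
  simp [box, Fin.forall_fin_succ, Fin.cons_inj, and_comm]

lemma sum_compCount_box_le {d : ℕ} {G : SimpleGraph (Word d)} (hG : HasPartners G) {t : ℕ}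
    (ht : t ≤ d) :
    (∑ Q : Fin d → Pair, compCount G (box Q t)) * 6 ^ t ≤ 6 ^ d * 2 ^ d * 5 ^ t := by
  induction d generalizing t with
  | zero =>
    obtain rfl : t = 0 := by omega
    simpa [box_zero] using hG.compCount_le
  | succ d ih =>
    obtain _ | t := t
    · simpa [box_zero, Nat.choose_two_right] using hG.compCount_le
    have hstep : ∀ Q : Fin d → Pair,
        2 * ∑ P : Pair, compCount G (box (Fin.cons P Q : Fin (d + 1) → Pair) (t + 1)) ≤
          5 * ∑ a, compCount (G.comap (prepend a)) (box Q t) := fun Q => by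
      simp only [box_cons]
      refine (sum_compCount_biUnion_le G _ ?_).trans (Nat.mul_le_mul_left 5
        (Finset.sum_le_sum fun a _ =>
          compCount_image_le G (SimpleGraph.Hom.comap (prepend a) G) (box Q t)))
      rintro a _ ⟨y, hy, rfl⟩
      obtain ⟨c, hc, hadj⟩ := hG (prepend a y) 0
      exact ⟨c, by simpa using hc, _, ⟨y, hy, rfl⟩, by simpa using hadj⟩
    have hih : (∑ Q : Fin d → Pair, ∑ a, compCount (G.comap (prepend a)) (box Q t)) * 6 ^ t ≤
        4 * (6 ^ d * 2 ^ d * 5 ^ t) := by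
      rw [Finset.sum_comm, Finset.sum_mul]
      exact (Finset.sum_le_card_nsmul _ _ _ fun a _ => ih (hG.comap_cons a) (by omega)).trans_eq
        (by simp)
    have hsum : 2 * ∑ Q : Fin (d + 1) → Pair, compCount G (box Q (t + 1)) ≤
        5 * ∑ Q : Fin d → Pair, ∑ a, compCount (G.comap (prepend a)) (box Q t) := by
      rw [← (Fin.consEquiv fun _ : Fin (d + 1) => Pair).sum_comp, Fintype.sum_prod_type_right,
        Finset.mul_sum, Finset.mul_sum]
      exact Finset.sum_le_sum fun Q _ => hstep Q
    have := Nat.mul_le_mul_right (6 ^ t) hsum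
    ring_nf at *
    omega

end RandomBoxes

section Counting

variable {α β γ δ : Type*} [Finite α]

lemma ncard_image_le_ncard_image (s : Set α) {A : α → β} {B : α → γ}
    (h : ∀ x ∈ s, ∀ y ∈ s, B x = B y → A x = A y) : (A '' s).ncard ≤ (B '' s).ncard := by
  choose r hrs hr using fun b : B '' s => b.2
  have hsub : A '' s ⊆ Set.range fun b => A (r b) := by
    rintro _ ⟨x, hx, rfl⟩
    have hBx := Set.mem_image_of_mem B hx
    exact ⟨⟨B x, hBx⟩, h _ (hrs _) _ hx (hr _)⟩
  rw [← Nat.card_coe_set_eq (B '' s)]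
  exact (Set.ncard_le_ncard hsub).trans (Finite.card_range_le _)

lemma ncard_image_le_mul (s : Set α) {A : α → β} {B : α → γ} (C : α → δ) {k : ℕ}
    (hdet : ∀ x ∈ s, ∀ y ∈ s, B x = B y → C x = C y → A x = A y)
    (hk : ∀ x ∈ s, (C '' {y ∈ s | B y = B x}).ncard ≤ k) :
    (A '' s).ncard ≤ k * (B '' s).ncard := by
  classical
  have hpair := ncard_image_le_ncard_image s (A := A) (B := fun x => (B x, C x))
    fun x hx y hy hxy => hdet x hx y hy (Prod.mk.inj hxy).1 (Prod.mk.inj hxy).2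
  refine hpair.trans ?_
  have := Fintype.ofFinite α
  rw [← Set.coe_toFinset s, ← Finset.coe_image, ← Finset.coe_image, Set.ncard_coe_finset,
    Set.ncard_coe_finset]
  refine Finset.card_le_mul_card_image_of_maps_to (f := Prod.fst) ?_ k ?_
  · simp only [Finset.mem_image, forall_exists_index, and_imp]
    rintro _ x hx rfl
    exact ⟨x, hx, rfl⟩
  · simp only [Finset.mem_image, Set.mem_toFinset, forall_exists_index, and_imp]
    rintro _ x hx rfl
    refine le_trans ?_ (hk x hx)
    rw [← Set.ncard_coe_finset,
      ← Set.ncard_image_of_injective (C '' _) (Prod.mk_right_injective (B x))]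
    refine Set.ncard_le_ncard (t := Prod.mk (B x) '' (C '' {y ∈ s | B y = B x})) ?_
      (Set.toFinite _)
    rintro ⟨b, c⟩
    simp only [Finset.coe_filter, Finset.mem_image, Set.mem_toFinset]
    rintro ⟨⟨y, hy, h⟩, rfl⟩
    obtain ⟨hb, rfl⟩ := Prod.mk.inj h
    exact ⟨_, ⟨y, ⟨hy, hb⟩, rfl⟩, rfl⟩

lemma ncard_le_mul_ncard_image (s : Set α) {B : α → γ} {k : ℕ}
    (hk : ∀ x ∈ s, {y ∈ s | B y = B x}.ncard ≤ k) : s.ncard ≤ k * (B '' s).ncard := by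
  simpa using ncard_image_le_mul s (A := id) id (fun _ _ _ _ _ h => h) (by simpa using hk)

end Counting

section Latin

/-- The Latin hypercubes of order four: functions whose restriction to every line is injective. -/
def IsLatin {d : ℕ} (f : Word d → Fin 4) : Prop :=
  ∀ x i, Injective fun c => f (update x i c)

/-- The set of Latin hypercubes of dimension `d`. -/
def latinSet (d : ℕ) : Set (Word d → Fin 4) := {f | IsLatin f}

/-- The Hamming graph `H(d, 4)`. -/
abbrev hammingGraph (d : ℕ) : SimpleGraph (Word d) := cartesianPower ⊤ d

lemma cartesianPower_adj_iff {α : Type*} {G : SimpleGraph α} {k : ℕ} {x y : Fin k → α} :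
    (cartesianPower G k).Adj x y ↔ ∃ i c, G.Adj (x i) c ∧ y = update x i c := by
  constructor
  · rintro ⟨i, hi, h⟩
    exact ⟨i, y i, hi, eq_update_iff.2 ⟨rfl, fun j hj => (h j hj).symm⟩⟩
  · rintro ⟨i, c, hc, rfl⟩
    exact ⟨i, by rwa [update_self], fun j hj => (update_of_ne hj _ _).symm⟩

lemma hammingGraph_adj_iff {d : ℕ} {y z : Word d} :
    (hammingGraph d).Adj y z ↔ ∃ i c, c ≠ y i ∧ z = update y i c :=
  cartesianPower_adj_iff.trans (exists₂_congr fun _ _ => and_congr_left' ne_comm)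

lemma hammingGraph_adj_update {d : ℕ} {y : Word d} {i : Fin d} {c : Fin 4} (hc : c ≠ y i) :
    (hammingGraph d).Adj y (update y i c) :=
  hammingGraph_adj_iff.2 ⟨i, c, hc, rfl⟩

/-- The word of length `d + 1` obtained by inserting the letter `a` at position `t`. -/
abbrev insertLetter {d : ℕ} (t : Fin (d + 1)) (a : Fin 4) (y : Word d) : Word (d + 1) :=
  t.insertNth a y

/-- The link graph of a family of lists of letters: adjacent words are joined when some letter lies
in both lists or in neither. For two-element lists both conditions say that the lists meet. -/
def linkGraph {d : ℕ} (L : Word d → Fin 4 → Bool) : SimpleGraph (Word d) where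
  Adj y z := (hammingGraph d).Adj y z ∧ ∃ v, L y v = L z v
  symm := ⟨fun _ _ ⟨h, v, hv⟩ => ⟨h.symm, v, hv.symm⟩⟩
  loopless := ⟨fun _ h => h.1.ne rfl⟩

/-- The list at `y` holds the values of `f` on the words obtained from `y` by inserting a letter of
`P` at position `t`. -/
def pairList {d : ℕ} (f : Word (d + 1) → Fin 4) (t : Fin (d + 1)) (P : Finset (Fin 4)) :
    Word d → Fin 4 → Bool :=
  fun y v => decide (∃ a ∈ P, f (insertLetter t a y) = v)

variable {d : ℕ} {f g : Word (d + 1) → Fin 4} {t : Fin (d + 1)} {P : Finset (Fin 4)} {y z : Word d}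

lemma IsLatin.injective_insertLetter (hf : IsLatin f) (t : Fin (d + 1)) (y : Word d) :
    Injective fun a => f (insertLetter t a y) := by
  simpa [Fin.update_insertNth] using hf (insertLetter t 0 y) t

lemma pairList_compl (hf : IsLatin f) (t : Fin (d + 1)) (P : Finset (Fin 4)) (y : Word d)
    (v : Fin 4) : pairList f t Pᶜ y v = !pairList f t P y v := by
  obtain ⟨a, rfl⟩ := Finite.surjective_of_injective (hf.injective_insertLetter t y) v
  simp [pairList, (hf.injective_insertLetter t y).eq_iff]

lemma linkGraph_pairList_compl (hf : IsLatin f) (t : Fin (d + 1)) (P : Finset (Fin 4)) :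
    linkGraph (pairList f t Pᶜ) = linkGraph (pairList f t P) := by
  ext y z
  simp [linkGraph, pairList_compl hf]

/-- The pair of the other two letters. -/
def Pair.compl (P : Pair) : Pair := ⟨P.1ᶜ, by simp [Finset.card_compl, P.2]⟩

lemma Pair.exists_ne (P : Pair) {a : Fin 4} (ha : a ∈ P.1) :
    ∃ b ∈ P.1, b ≠ a ∧ ∀ c ∈ P.1, c = a ∨ c = b := by
  decide +revert

lemma IsLatin.hasPartners_linkGraph (hf : IsLatin f) (t : Fin (d + 1)) (P : Pair) :
    HasPartners (linkGraph (pairList f t P.1)) := fun y i => by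
  obtain ⟨a, ha⟩ := Finset.card_pos.1 (P.2.symm ▸ Nat.two_pos)
  obtain ⟨b, hb, hba, -⟩ := P.exists_ne ha
  obtain ⟨c, hc⟩ := Finite.surjective_of_injective
    (hf (insertLetter t b y) (t.succAbove i)) (f (insertLetter t a y))
  simp only [← Fin.insertNth_update] at hc
  have hcy : c ≠ y i := by
    rintro rfl
    rw [update_eq_self] at hc
    exact hba (hf.injective_insertLetter t y hc)
  refine ⟨c, hcy, hammingGraph_adj_update hcy, f (insertLetter t a y), ?_⟩
  simp only [pairList, decide_eq_decide]
  exact ⟨fun _ => ⟨b, hb, hc⟩, fun _ => ⟨a, ha, rfl⟩⟩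

/-- The slab of the words whose letter at position `t` lies in `P` and whose other letters form a
word of `R`. -/
def slab (t : Fin (d + 1)) (P : Finset (Fin 4)) (R : Set (Word d)) : Set (Word (d + 1)) :=
  {z | z t ∈ P ∧ t.removeNth z ∈ R}

/-- `f` and `g` agree after inserting a letter of `P` at position `t` of `y`. -/
def AgreeAt (f g : Word (d + 1) → Fin 4) (t : Fin (d + 1)) (P : Finset (Fin 4)) (y : Word d) :
    Prop :=
  ∀ a ∈ P, f (insertLetter t a y) = g (insertLetter t a y)

lemma eqOn_slab {R : Set (Word d)} (h : ∀ y ∈ R, AgreeAt f g t P y) :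
    Set.EqOn f g (slab t P R) := fun z hz => by
  simpa using h _ hz.2 _ hz.1

lemma IsLatin.card_pairList (hf : IsLatin f) (t : Fin (d + 1)) (P : Pair) (y : Word d) :
    (Finset.univ.filter fun v => pairList f t P.1 y v = true).card = 2 := by
  refine (congrArg Finset.card ?_).trans
    ((Finset.card_image_of_injective P.1 (hf.injective_insertLetter t y)).trans P.2)
  ext v
  simp [pairList]

lemma exists_common_of_eq : ∀ {L M : Fin 4 → Bool}, (Finset.univ.filter (L · = true)).card = 2 →
    (Finset.univ.filter (M · = true)).card = 2 → ∀ {v}, L v = M v →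
      ∃ w, L w = true ∧ M w = true := by
  decide

lemma agree_or_swap (hf : IsLatin f) {P : Pair}
    (h : pairList g t P.1 y = pairList f t P.1 y) {a b : Fin 4} (ha : a ∈ P.1) (hb : b ∈ P.1)
    (hab : a ≠ b) :
    AgreeAt f g t P.1 y ∨
      f (insertLetter t a y) = g (insertLetter t b y) ∧
      f (insertLetter t b y) = g (insertLetter t a y) := by
  have hsub : ∀ c ∈ P.1, ∃ e ∈ P.1, g (insertLetter t e y) = f (insertLetter t c y) := by
    intro c hc
    have := congrFun h (f (insertLetter t c y))
    simp only [pairList, decide_eq_decide] at this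
    exact this.2 ⟨c, hc, rfl⟩
  have hP : ∀ c ∈ P.1, c = a ∨ c = b := by
    obtain ⟨b', -, -, hb'⟩ := P.exists_ne ha
    obtain rfl := (hb' b hb).resolve_left hab.symm
    exact hb'
  have hne := (hf.injective_insertLetter t y).ne hab
  have hcases : ∀ c ∈ P.1, f (insertLetter t c y) = g (insertLetter t a y) ∨
      f (insertLetter t c y) = g (insertLetter t b y) := fun c hc => by
    obtain ⟨e, he, hec⟩ := hsub c hc
    rcases hP e he with rfl | rfl
    · exact .inl hec.symm
    · exact .inr hec.symm
  rcases hcases a ha with haa | haa <;> rcases hcases b hb with hbb | hbb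
  · exact absurd (haa.trans hbb.symm) hne
  · exact .inl fun c hc => by rcases hP c hc with rfl | rfl <;> assumption
  · exact .inr ⟨haa, hbb⟩
  · exact absurd (haa.trans hbb.symm) hne

lemma IsLatin.insertLetter_ne_of_adj (hf : IsLatin f) (h : (hammingGraph d).Adj y z)
    (t : Fin (d + 1)) (a : Fin 4) : f (insertLetter t a y) ≠ f (insertLetter t a z) := by
  obtain ⟨i, c, hc, rfl⟩ := hammingGraph_adj_iff.1 h
  have := (hf (insertLetter t a y) (t.succAbove i)).ne hc
  simpa [← Fin.insertNth_update] using this.symm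

lemma AgreeAt.of_linkGraph_adj (hf : IsLatin f) (hg : IsLatin g) {P : Pair}
    (hz : pairList g t P.1 z = pairList f t P.1 z) (h : (linkGraph (pairList f t P.1)).Adj y z)
    (hy : AgreeAt f g t P.1 y) : AgreeAt f g t P.1 z := by
  obtain ⟨hadj, v, hv⟩ := h
  obtain ⟨w, hyw, hzw⟩ := exists_common_of_eq (hf.card_pairList t P y) (hf.card_pairList t P z) hv
  simp only [pairList, decide_eq_true_eq] at hyw hzw
  obtain ⟨a, ha, rfl⟩ := hyw
  obtain ⟨b, hb, hba⟩ := hzw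
  obtain rfl | hne := eq_or_ne a b
  · exact absurd hba.symm (hf.insertLetter_ne_of_adj hadj t a)
  refine (agree_or_swap hf hz ha hb hne).resolve_right fun hswap => ?_
  exact hg.insertLetter_ne_of_adj hadj t a (by rw [← hy a ha, ← hba, hswap.2])

lemma ncard_domRestrict_slab_le (t : Fin (d + 1)) (P : Pair) (R : Set (Word d)) (hf : IsLatin f)
    {s : Set (Word (d + 1) → Fin 4)}
    (hs : ∀ g ∈ s, IsLatin g ∧ ∀ y ∈ R, pairList g t P.1 y = pairList f t P.1 y) :
    ((slab t P.1 R).domRestrict '' s).ncard ≤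
      2 ^ compCount (linkGraph (pairList f t P.1)) R := by
  classical
  let H := (linkGraph (pairList f t P.1)).induce R
  have hconst : ∀ g ∈ s, ∀ {y z : R}, H.Reachable y z →
      (AgreeAt f g t P.1 y ↔ AgreeAt f g t P.1 z) := fun g hg y z hyz => by
    obtain ⟨hlat, hlist⟩ := hs g hg
    refine hyz.elim fun p => ?_
    induction p with
    | nil => rfl
    | @cons u v w h _ ih =>
      exact Iff.trans ⟨.of_linkGraph_adj hf hlat (hlist _ v.2) h,
        .of_linkGraph_adj hf hlat (hlist _ u.2) (SimpleGraph.Adj.symm h)⟩ (ih ⟨‹_›⟩)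
  let bits : (Word (d + 1) → Fin 4) → H.ConnectedComponent → Prop :=
    fun g c => ∃ y ∈ c.supp, AgreeAt f g t P.1 y
  have hbits : ∀ g ∈ s, ∀ y : R, bits g (H.connectedComponentMk y) ↔ AgreeAt f g t P.1 y :=
    fun g hg y => ⟨fun ⟨z, hz, h⟩ => (hconst g hg (SimpleGraph.ConnectedComponent.exact hz)).1 h,
      fun h => ⟨y, rfl, h⟩⟩
  have hdet : ∀ g ∈ s, ∀ g' ∈ s, bits g = bits g' →
      (slab t P.1 R).domRestrict g = (slab t P.1 R).domRestrict g' := fun g hg g' hg' h => by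
    refine Set.domRestrict_eq_domRestrict_iff.2 (eqOn_slab fun y hy a ha => ?_)
    have hiff : AgreeAt f g t P.1 y ↔ AgreeAt f g' t P.1 y := by
      rw [← hbits g hg ⟨y, hy⟩, ← hbits g' hg' ⟨y, hy⟩, h]
    obtain ⟨b, hb, hba, -⟩ := P.exists_ne ha
    by_cases hagree : AgreeAt f g t P.1 y
    · rw [← hagree a ha, ← hiff.1 hagree a ha]
    · rw [← ((agree_or_swap hf ((hs g hg).2 y hy) ha hb hba.symm).resolve_left
        hagree).2, ← ((agree_or_swap hf ((hs g' hg').2 y hy) ha hb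
          hba.symm).resolve_left (mt hiff.2 hagree)).2]
  calc _ ≤ (bits '' s).ncard := ncard_image_le_ncard_image s hdet
    _ ≤ Nat.card (H.ConnectedComponent → Prop) := Set.ncard_le_card _
    _ = 2 ^ compCount (linkGraph (pairList f t P.1)) R := by
      simp [compCount, H]

end Latin

section Stages

variable {d : ℕ}

lemma mem_box_succ {Q : Fin (d + 1) → Pair} {t : Fin (d + 1)} {z : Word (d + 1)} :
    z ∈ box Q (t + 1) ↔ z ∈ box Q t ∧ z t ∈ (Q t).1 := by
  simp only [box, Set.mem_ofPred_eq, Nat.lt_succ_iff_lt_or_eq, or_imp, forall_and, Fin.val_inj,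
    forall_eq]

lemma mem_box_iff_removeNth {Q : Fin (d + 1) → Pair} {t : Fin (d + 1)} {z : Word (d + 1)} :
    z ∈ box Q t ↔ t.removeNth z ∈ box (t.removeNth Q) t := by
  have hlt : ∀ i : Fin d, (t.succAbove i : ℕ) < t ↔ (i : ℕ) < t := fun i =>
    Fin.succAbove_lt_iff_castSucc_lt t i
  simp only [box, Set.mem_ofPred_eq, Fin.removeNth, Fin.forall_iff_succAbove t, lt_irrefl,
    false_imp_iff, true_and, hlt]

/-- The number of components of the link graph at stage `t` of the exposure of `f`, in which the
letters at the positions before `t` are confined to the pairs `Q`. Knowing `f` on the words whose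
letter at position `t` is in `Q t`, this many bits determine it on the other ones. -/
noncomputable def stageLoss (f : Word (d + 1) → Fin 4) (Q : Fin (d + 1) → Pair)
    (t : Fin (d + 1)) : ℕ :=
  compCount (linkGraph (pairList f t (Q t).1)) (box (t.removeNth Q) t)

lemma ncard_domRestrict_box_le (Q : Fin (d + 1) → Pair) (t : Fin (d + 1)) {ℓ : ℕ}
    {s : Set (Word (d + 1) → Fin 4)} (hs : ∀ f ∈ s, IsLatin f ∧ stageLoss f Q t ≤ ℓ) :
    ((box Q t).domRestrict '' s).ncard ≤ 2 ^ ℓ * ((box Q (t + 1)).domRestrict '' s).ncard := by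
  let R := box (t.removeNth Q) t
  refine ncard_image_le_mul s (slab t (Q t).compl.1 R).domRestrict ?_ fun f hf => ?_
  · intro f _ g _ hbox hslab
    rw [Set.domRestrict_eq_domRestrict_iff] at *
    intro z hz
    by_cases hzt : z t ∈ (Q t).1
    · exact hbox (mem_box_succ.2 ⟨hz, hzt⟩)
    · exact hslab ⟨Finset.mem_compl.2 hzt, mem_box_iff_removeNth.1 hz⟩
  · obtain ⟨hlat, hloss⟩ := hs f hf
    refine (ncard_domRestrict_slab_le t (Q t).compl R hlat
      fun g hg => ⟨(hs g hg.1).1, fun y hy => ?_⟩).trans (Nat.pow_le_pow_right two_pos ?_)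
    · have hgf := Set.domRestrict_eq_domRestrict_iff.1 hg.2
      have hmem : ∀ a ∈ (Q t).1, insertLetter t a y ∈ box Q (t + 1) := fun a ha =>
        mem_box_succ.2 ⟨mem_box_iff_removeNth.2 (by simpa using hy), by simpa using ha⟩
      ext v
      rw [Pair.compl, pairList_compl hlat, pairList_compl (hs g hg.1).1]
      exact congrArg not (decide_eq_decide.2
        (exists_congr fun a => and_congr_right fun ha => by rw [hgf (hmem a ha)]))
    · rwa [Pair.compl, linkGraph_pairList_compl hlat]

lemma ncard_le_of_stageLoss_le (Q : Fin (d + 1) → Pair) {ℓ : Fin (d + 1) → ℕ}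
    {s : Set (Word (d + 1) → Fin 4)} (hs : ∀ f ∈ s, IsLatin f ∧ ∀ t, stageLoss f Q t ≤ ℓ t) :
    s.ncard ≤ 2 ^ (∑ t, ℓ t) * ((box Q (d + 1)).domRestrict '' s).ncard := by
  have hstage : ∀ t ≤ d + 1, s.ncard ≤
      2 ^ (∑ i with Fin.val i < t, ℓ i) * ((box Q t).domRestrict '' s).ncard := by
    intro t ht
    induction t with
    | zero =>
      rw [box_zero, Set.ncard_image_of_injective]
      · simp
      · exact fun f g h => funext fun z =>
          Set.domRestrict_eq_domRestrict_iff.1 h (Set.mem_univ z)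
    | succ t ih =>
      have hsplit : Finset.univ.filter (fun i : Fin (d + 1) => Fin.val i < t + 1) =
          insert ⟨t, ht⟩ (Finset.univ.filter fun i => Fin.val i < t) := by
        ext i
        simp only [Finset.mem_filter_univ, Finset.mem_insert, Fin.ext_iff,
          Nat.lt_succ_iff_lt_or_eq, or_comm]
      rw [hsplit, Finset.sum_insert (by simp), add_comm (ℓ _), pow_add, mul_assoc]
      exact (ih (by omega)).trans (Nat.mul_le_mul_left _
        (ncard_domRestrict_box_le Q ⟨t, ht⟩ fun f hf => ⟨(hs f hf).1, (hs f hf).2 _⟩))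
  simpa only [Fin.is_lt, Finset.filter_true] using hstage (d + 1) le_rfl

/-- Proper colourings of the `d`-dimensional cube with four colours. -/
def IsCubeColoring {d : ℕ} (φ : (Fin d → Bool) → Fin 4) : Prop :=
  ∀ ω i, φ (update ω i (!ω i)) ≠ φ ω

/-- The number of proper colourings of the `d`-dimensional cube with four colours. -/
noncomputable def cubeColoringCount (d : ℕ) : ℕ :=
  {φ : (Fin d → Bool) → Fin 4 | IsCubeColoring φ}.ncard

lemma Pair.exists_bool :
    ∀ P : Pair, ∃ e : Bool → Fin 4, Injective e ∧ ∀ a, a ∈ P.1 ↔ ∃ b, e b = a := by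
  unfold Injective
  decide

lemma ncard_domRestrict_full_box_le (Q : Fin d → Pair) {s : Set (Word d → Fin 4)}
    (hs : ∀ f ∈ s, IsLatin f) : ((box Q d).domRestrict '' s).ncard ≤ cubeColoringCount d := by
  choose e he heQ using fun i => (Q i).exists_bool
  let cube : (Word d → Fin 4) → (Fin d → Bool) → Fin 4 := fun f ω => f fun i => e i (ω i)
  have hdet : ∀ f ∈ s, ∀ g ∈ s, cube f = cube g →
      (box Q d).domRestrict f = (box Q d).domRestrict g := fun f _ g _ h => by
    refine Set.domRestrict_eq_domRestrict_iff.2 fun z hz => ?_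
    choose ω hω using fun i => (heQ i _).1 (hz i i.2)
    simpa only [cube, hω] using congrFun h ω
  refine (ncard_image_le_ncard_image s hdet).trans (Set.ncard_le_ncard ?_ (Set.toFinite _))
  rintro _ ⟨f, hf, rfl⟩ ω i heq
  have hupd : (fun j => e j (update ω i (!ω i) j)) =
      update (fun j => e j (ω j)) i (e i (!ω i)) := by
    ext j
    rcases eq_or_ne j i with rfl | hj <;> simp [*]
  have hline := hs f hf (fun j => e j (ω j)) i (a₁ := e i (!ω i)) (a₂ := e i (ω i))
    (by simpa [cube, hupd] using heq)
  simpa using he i hline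

lemma ncard_sum_stageLoss_le (Q : Fin (d + 1) → Pair) (Λ : ℕ) :
    {f ∈ latinSet (d + 1) | ∑ t, stageLoss f Q t ≤ Λ}.ncard ≤
      (Λ + 1) ^ (d + 1) * (2 ^ Λ * cubeColoringCount (d + 1)) := by
  have hfib := ncard_le_mul_ncard_image {f ∈ latinSet (d + 1) | ∑ t, stageLoss f Q t ≤ Λ}
    (B := fun f => stageLoss f Q) (k := 2 ^ Λ * cubeColoringCount (d + 1)) fun f hf =>
      (ncard_le_of_stageLoss_le Q fun g hg => ⟨hg.1.1, fun t => (congrFun hg.2 t).le⟩).trans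
        (Nat.mul_le_mul (Nat.pow_le_pow_right two_pos hf.2)
          (ncard_domRestrict_full_box_le Q fun g hg => hg.1.1))
  rw [mul_comm] at hfib
  refine hfib.trans (Nat.mul_le_mul_right _ ?_)
  calc _ ≤ (Set.pi Set.univ fun _ : Fin (d + 1) => Set.Iio (Λ + 1)).ncard := by
        refine Set.ncard_le_ncard ?_ (Set.Finite.pi fun _ => Set.finite_Iio _)
        rintro _ ⟨f, hf, rfl⟩ t -
        exact Nat.lt_succ_of_le
          ((Finset.single_le_sum (fun _ _ => Nat.zero_le _) (Finset.mem_univ t)).trans hf.2)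
    _ = (Λ + 1) ^ (d + 1) := by
      rw [← Finset.coe_Iio, ← Fintype.coe_piFinset, Set.ncard_coe_finset]
      simp

lemma sum_stageLoss_le {f : Word (d + 1) → Fin 4} (hf : IsLatin f) (t : Fin (d + 1)) :
    (∑ Q, stageLoss f Q t) * 6 ^ (t : ℕ) ≤ 6 ^ (d + 1) * 2 ^ d * 5 ^ (t : ℕ) := by
  rw [← (Fin.insertNthEquiv (fun _ => Pair) t).sum_comp, Fintype.sum_prod_type, Finset.sum_mul]
  simp only [stageLoss, Fin.insertNthEquiv, Equiv.coe_fn_mk, Fin.insertNth_apply_same,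
    Fin.removeNth_insertNth]
  refine (Finset.sum_le_card_nsmul _ _ _ fun P _ =>
    sum_compCount_box_le (hf.hasPartners_linkGraph t P) t.is_le).trans_eq ?_
  simp [Nat.choose_two_right]
  ring

end Stages

section CubeColorings

open MeasureTheory
open scoped ENNReal

section Finner

variable {ι U : Type*} [DecidableEq ι] [Fintype U] {X : ι → Type*} [∀ i, MeasurableSpace (X i)]
  (μ : ∀ i, Measure (X i)) [∀ i, IsProbabilityMeasure (μ i)] {p : U → ℝ}
  {f : U → (∀ i, X i) → ℝ≥0∞}

lemma lmarginal_insert_eq {i : ι} {s : Finset ι} (hi : i ∉ s) {g : (∀ i, X i) → ℝ≥0∞}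
    (hg : Measurable g) (hgi : ∀ x c, g (update x i c) = g x) (x : ∀ i, X i) (c : X i) :
    (∫⋯∫⁻_insert i s, g ∂μ) x = (∫⋯∫⁻_s, g ∂μ) (update x i c) := by
  have h : ∀ c, (∫⋯∫⁻_s, g ∂μ) (update x i c) = (∫⋯∫⁻_s, g ∂μ) x := fun c => by
    rw [lmarginal_update_of_notMem hg hi]
    exact congrArg (fun g => (∫⋯∫⁻_s, g ∂μ) x) (funext fun y => hgi y c)
  simp [lmarginal_insert _ hg hi, h]

lemma lmarginal_insert_prod_rpow_le (hp : ∀ u, 0 ≤ p u) (hf : ∀ u, Measurable (f u)) {i : ι}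
    {s : Finset ι} (hi : i ∉ s) {D : Finset U} (hD : ∑ u ∈ D, p u = 1)
    (hfD : ∀ u ∉ D, ∀ x c, f u (update x i c) = f u x)
    (hs : ∀ x, (∫⋯∫⁻_s, (fun x => ∏ u, f u x ^ p u) ∂μ) x ≤ ∏ u, ((∫⋯∫⁻_s, f u ∂μ) x) ^ p u)
    (x : ∀ i, X i) :
    (∫⋯∫⁻_insert i s, (fun x => ∏ u, f u x ^ p u) ∂μ) x ≤
      ∏ u, ((∫⋯∫⁻_insert i s, f u ∂μ) x) ^ p u := by
  classical
  have hmeas : ∀ u, Measurable fun c => (∫⋯∫⁻_s, f u ∂μ) (update x i c) :=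
    fun u => ((hf u).lmarginal μ).comp (measurable_update x)
  calc (∫⋯∫⁻_insert i s, (fun x => ∏ u, f u x ^ p u) ∂μ) x
      ≤ ∫⁻ c, ∏ u, ((∫⋯∫⁻_s, f u ∂μ) (update x i c)) ^ p u ∂μ i := by
        rw [lmarginal_insert _ (Finset.measurable_fun_prod _ fun u _ => (hf u).pow_const _) hi]
        exact lintegral_mono fun c => hs _
    _ = (∫⁻ c, ∏ u ∈ D, ((∫⋯∫⁻_s, f u ∂μ) (update x i c)) ^ p u ∂μ i) *
          ∏ u ∈ Dᶜ, ((∫⋯∫⁻_insert i s, f u ∂μ) x) ^ p u := by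
        rw [← lintegral_mul_const _ (Finset.measurable_fun_prod _ fun u _ =>
          (hmeas u).pow_const _)]
        refine lintegral_congr fun c => ?_
        rw [← Finset.prod_mul_prod_compl D]
        congr 1
        exact Finset.prod_congr rfl fun u hu => by
          rw [lmarginal_insert_eq μ hi (hf u) (hfD u (Finset.mem_compl.1 hu)) x c]
    _ ≤ (∏ u ∈ D, ((∫⋯∫⁻_insert i s, f u ∂μ) x) ^ p u) *
          ∏ u ∈ Dᶜ, ((∫⋯∫⁻_insert i s, f u ∂μ) x) ^ p u := by
        gcongr
        simp only [lmarginal_insert _ (hf _) hi]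
        exact ENNReal.lintegral_prod_norm_pow_le D (fun u _ => (hmeas u).aemeasurable) hD
          fun u _ => hp u
    _ = _ := Finset.prod_mul_prod_compl _ _

lemma finner_inequality [Fintype ι] (hp : ∀ u, 0 ≤ p u) (hf : ∀ u, Measurable (f u))
    {D : ι → Finset U} (hD : ∀ i, ∑ u ∈ D i, p u = 1)
    (hfD : ∀ i, ∀ u ∉ D i, ∀ x c, f u (update x i c) = f u x) :
    ∫⁻ x, ∏ u, f u x ^ p u ∂Measure.pi μ ≤ ∏ u, (∫⁻ x, f u x ∂Measure.pi μ) ^ p u := by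
  have hmarginal : ∀ (s : Finset ι) (x : ∀ i, X i),
      (∫⋯∫⁻_s, (fun x => ∏ u, f u x ^ p u) ∂μ) x ≤ ∏ u, ((∫⋯∫⁻_s, f u ∂μ) x) ^ p u := fun s => by
    induction s using Finset.induction_on with
    | empty => simp
    | insert i s hi ih => exact lmarginal_insert_prod_rpow_le μ hp hf hi (hD i) (hfD i) ih
  obtain ⟨x⟩ : Nonempty (∀ i, X i) := (Measure.pi μ).nonempty_of_neZero
  simpa only [lintegral_eq_lmarginal_univ x] using hmarginal Finset.univ x

end Finner

variable {d : ℕ}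

lemma exists_cube_parity (d : ℕ) :
    ∃ p : (Fin d → Bool) → Bool, ∀ v i, p (update v i (!v i)) = !p v := by
  induction d with
  | zero => exact ⟨fun _ => true, fun _ i => i.elim0⟩
  | succ d ih =>
    obtain ⟨p, hp⟩ := ih
    refine ⟨fun v => xor (v 0) (p (Fin.tail v)), fun v i => ?_⟩
    cases i using Fin.cases with
    | zero => simp [Fin.tail_update_zero]
    | succ i =>
      simp only [Fin.tail_update_succ]
      rw [update_of_ne (Fin.succ_ne_zero i).symm, show v i.succ = Fin.tail v i from rfl, hp,
        Bool.xor_not]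

/-- A vertex of the cube together with its neighbours. -/
def closedNeighbors (v : Fin d → Bool) : Finset (Fin d → Bool) :=
  insert v (Finset.univ.image fun i => update v i (!v i))

lemma card_closedNeighbors (v : Fin d → Bool) : (closedNeighbors v).card = d + 1 := by
  rw [closedNeighbors, Finset.card_insert_of_notMem, Finset.card_image_of_injective]
  · simp
  · intro i j h
    by_contra hij
    have := congrFun h i
    simp [hij] at this
  · simp only [Finset.mem_image, Finset.mem_univ, true_and, not_exists]
    intro i h
    simpa using congrFun h i

lemma mem_closedNeighbors {v w : Fin d → Bool} :
    v ∈ closedNeighbors w ↔ v = w ∨ ∃ i, update w i (!w i) = v := by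
  simp [closedNeighbors]

lemma mem_closedNeighbors_comm {v w : Fin d → Bool} (h : v ∈ closedNeighbors w) :
    w ∈ closedNeighbors v := by
  rw [mem_closedNeighbors] at *
  rcases h with rfl | ⟨i, rfl⟩
  · exact .inl rfl
  · exact .inr ⟨i, by simp⟩

-- The even words carry an arbitrary colouring; each odd word then avoids the colours around it.
lemma cubeColoringCount_succ_le (d : ℕ) :
    cubeColoringCount (d + 1) ≤ ∑ g : (Fin d → Bool) → Fin 4, ∏ v : Fin d → Bool,
      ((closedNeighbors v).image g)ᶜ.card := by
  obtain ⟨p, hp⟩ := exists_cube_parity d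
  let even (φ : (Fin (d + 1) → Bool) → Fin 4) (v : Fin d → Bool) := φ (Fin.cons (p v) v)
  let odd (φ : (Fin (d + 1) → Bool) → Fin 4) (v : Fin d → Bool) := φ (Fin.cons (!p v) v)
  let split (φ : (Fin (d + 1) → Bool) → Fin 4) : Σ _ : (Fin d → Bool) → Fin 4,
    (Fin d → Bool) → Fin 4 := ⟨even φ, odd φ⟩
  let pairs := Finset.univ.sigma fun g : (Fin d → Bool) → Fin 4 =>
    Fintype.piFinset fun v => ((closedNeighbors v).image g)ᶜ
  have hmaps : ∀ φ, IsCubeColoring φ → split φ ∈ pairs := fun φ hφ => by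
    simp only [pairs, split, Finset.mem_sigma, Finset.mem_univ, true_and, Fintype.mem_piFinset,
      Finset.mem_compl, Finset.mem_image, not_exists, not_and, mem_closedNeighbors]
    rintro v _ (rfl | ⟨i, rfl⟩)
    · simpa using (hφ (Fin.cons (p _) _) 0).symm
    · simpa [even, odd, hp, ← Fin.cons_update] using hφ (Fin.cons (!p v) v) i.succ
  have hinj : Injective split := fun φ φ' h => by
    obtain ⟨heven, hodd⟩ := Sigma.mk.inj h
    funext ω
    rw [← Fin.cons_self_tail ω]
    rcases Bool.eq_or_eq_not (ω 0) (p (Fin.tail ω)) with h0 | h0 <;> rw [h0]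
    · exact congrFun heven _
    · exact congrFun (eq_of_heq hodd) _
  refine (Set.ncard_le_ncard_of_injOn (t := pairs) split hmaps hinj.injOn).trans_eq ?_
  rw [Set.ncard_coe_finset]
  simp [pairs]

lemma card_image_eq_le {S : Finset (Fin d → Bool)} (C : Finset (Fin 4)) :
    (Finset.univ.filter fun g : (Fin d → Bool) → Fin 4 => S.image g = C).card * 4 ^ S.card ≤
      C.card ^ S.card * 4 ^ 2 ^ d := by
  have hsub : (Finset.univ.filter fun g : (Fin d → Bool) → Fin 4 => S.image g = C) ⊆
      Fintype.piFinset fun w => if w ∈ S then C else Finset.univ := fun g hg => by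
    rw [Fintype.mem_piFinset]
    intro w
    split_ifs with hw
    · exact (Finset.mem_filter_univ g).1 hg ▸ Finset.mem_image_of_mem g hw
    · exact Finset.mem_univ _
  have hcompl : (2 : ℕ) ^ d = Sᶜ.card + S.card := by simp [Finset.card_compl_add_card]
  refine (Nat.mul_le_mul_right _ (Finset.card_le_card hsub)).trans_eq ?_
  rw [Fintype.card_piFinset, ← Finset.prod_mul_prod_compl S,
    Finset.prod_congr rfl (g := fun _ => C.card) fun w hw => by rw [if_pos hw],
    Finset.prod_congr (s₁ := Sᶜ) rfl (g := fun _ => 4) fun w hw => by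
      rw [if_neg (Finset.mem_compl.1 hw), Finset.card_univ, Fintype.card_fin],
    Finset.prod_const, Finset.prod_const, hcompl, pow_add]
  ring

-- Grouping by the set `C` of colours around `v`, the `d + 1` words around `v` contribute
-- `|C|^(d+1)` colourings and the weight `|Cᶜ|^(d+1)`, where `|C||Cᶜ| ≤ 4`.
lemma sum_card_compl_pow_le (v : Fin d → Bool) :
    ∑ g : (Fin d → Bool) → Fin 4, ((closedNeighbors v).image g)ᶜ.card ^ (d + 1) ≤
      16 * 4 ^ 2 ^ d := by
  have hclass : ∀ C : Finset (Fin 4), (Finset.univ.filter fun g : (Fin d → Bool) → Fin 4 =>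
      (closedNeighbors v).image g = C).card * Cᶜ.card ^ (d + 1) ≤ 4 ^ 2 ^ d := fun C => by
    have hcount := card_image_eq_le (S := closedNeighbors v) C
    have hC : C.card * Cᶜ.card ≤ 4 := by
      clear hcount
      decide +revert
    rw [card_closedNeighbors] at hcount
    refine Nat.le_of_mul_le_mul_right ?_ (pow_pos four_pos (d + 1))
    calc _ ≤ C.card ^ (d + 1) * 4 ^ 2 ^ d * Cᶜ.card ^ (d + 1) := by
          rw [mul_right_comm]
          exact Nat.mul_le_mul_right _ hcount
      _ = 4 ^ 2 ^ d * (C.card * Cᶜ.card) ^ (d + 1) := by rw [mul_pow]; ring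
      _ ≤ _ := by gcongr
  rw [← Finset.sum_fiberwise_of_maps_to (t := Finset.univ)
    (g := fun g => (closedNeighbors v).image g) (by simp)]
  calc _ = ∑ C : Finset (Fin 4), _ * Cᶜ.card ^ (d + 1) :=
        Finset.sum_congr rfl fun _ _ => by
          rw [Finset.sum_congr rfl fun g hg => by rw [(Finset.mem_filter_univ g).1 hg],
            Finset.sum_const, smul_eq_mul]
    _ ≤ ∑ _C : Finset (Fin 4), 4 ^ 2 ^ d := Finset.sum_le_sum fun C _ => hclass C
    _ = 16 * 4 ^ 2 ^ d := by simp

lemma cubeColoringCount_succ_le_ennreal (d : ℕ) :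
    (cubeColoringCount (d + 1) : ℝ≥0∞) ≤ 4 ^ 2 ^ d * ((16 : ℝ≥0∞) ^ ((d + 1 : ℝ)⁻¹)) ^ 2 ^ d := by
  let weight (v : Fin d → Bool) (g : (Fin d → Bool) → Fin 4) : ℝ≥0∞ :=
    ((closedNeighbors v).image g)ᶜ.card
  let ν : Measure (Fin 4) := (4 : ℝ≥0∞)⁻¹ • Measure.count
  have : IsProbabilityMeasure ν := ⟨by simp [ν, ENNReal.inv_mul_cancel]⟩
  have hν : ∀ F : ((Fin d → Bool) → Fin 4) → ℝ≥0∞,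
      ∑ g, F g = 4 ^ 2 ^ d * ∫⁻ g, F g ∂Measure.pi fun _ => ν := fun F => by
    rw [lintegral_fintype]
    simp only [Measure.pi_singleton, ν, Measure.smul_apply, Measure.count_singleton, smul_eq_mul,
      mul_one, Finset.prod_const, Finset.card_univ, Fintype.card_fun, Fintype.card_bool,
      Fintype.card_fin]
    rw [← Finset.sum_mul, mul_left_comm, ← mul_pow, ENNReal.mul_inv_cancel (by simp) (by simp),
      one_pow, mul_one]
  have hfinner := finner_inequality (fun _ : Fin d → Bool => ν) (U := Fin d → Bool)
    (p := fun _ => (d + 1 : ℝ)⁻¹) (fun _ => by positivity)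
    (f := fun v g => weight v g ^ (d + 1)) (fun _ => measurable_of_finite _) (D := closedNeighbors)
    (fun v => by rw [Finset.sum_const, card_closedNeighbors]; simp; field_simp) fun w v hv g c => by
      have heq : Set.EqOn (update g w c) g (closedNeighbors v) := fun u hu => by
        rw [update_of_ne]
        rintro rfl
        exact hv (mem_closedNeighbors_comm hu)
      simp only [weight, Finset.image_congr heq]
  have hroot : ∀ v g, (weight v g ^ (d + 1)) ^ ((d + 1 : ℝ)⁻¹) = weight v g := fun v g => by
    exact_mod_cast ENNReal.pow_rpow_inv_natCast d.succ_ne_zero (weight v g)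
  have hmean : ∀ v, ∫⁻ g, weight v g ^ (d + 1) ∂Measure.pi (fun _ => ν) ≤ 16 := fun v => by
    have h : ∑ g, weight v g ^ (d + 1) ≤ 16 * 4 ^ 2 ^ d := by
      simp only [weight]
      exact_mod_cast sum_card_compl_pow_le v
    rw [hν, mul_comm] at h
    exact (ENNReal.mul_le_mul_iff_left (by simp) (by simp)).1 h
  simp only [hroot] at hfinner
  calc (cubeColoringCount (d + 1) : ℝ≥0∞) ≤ ∑ g, ∏ v, weight v g := by
        simp only [weight]
        exact_mod_cast cubeColoringCount_succ_le d
    _ ≤ 4 ^ 2 ^ d * ∏ _v : Fin d → Bool, (16 : ℝ≥0∞) ^ ((d + 1 : ℝ)⁻¹) := by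
        rw [hν]
        refine mul_le_mul_right (hfinner.trans (Finset.prod_le_prod' fun v _ => ?_)) _
        exact ENNReal.rpow_le_rpow (hmean v) (by positivity)
    _ = _ := by simp

lemma cubeColoringCount_succ_le_rpow (d : ℕ) :
    (cubeColoringCount (d + 1) : ℝ) ≤
      2 ^ ((2 : ℝ) ^ (d + 1) + 2 ^ (d + 2) / (d + 1)) := by
  have h4 : (4 : ℝ) = 2 ^ (2 : ℝ) := by norm_num
  have h16 : (16 : ℝ) = 2 ^ (4 : ℝ) := by norm_num
  have hfin : (4 : ℝ≥0∞) ^ 2 ^ d * ((16 : ℝ≥0∞) ^ ((d + 1 : ℝ)⁻¹)) ^ 2 ^ d ≠ ⊤ :=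
    ENNReal.mul_ne_top (by simp) (ENNReal.pow_ne_top (ENNReal.rpow_ne_top_of_nonneg
      (by positivity) (by simp)))
  calc (cubeColoringCount (d + 1) : ℝ) ≤ 4 ^ 2 ^ d * ((16 : ℝ) ^ ((d + 1 : ℝ)⁻¹)) ^ 2 ^ d := by
        simpa [← ENNReal.toReal_rpow] using
          ENNReal.toReal_mono hfin (cubeColoringCount_succ_le_ennreal d)
    _ = _ := by
        rw [h16, h4, ← Real.rpow_natCast, ← Real.rpow_natCast, ← Real.rpow_mul two_pos.le,
          ← Real.rpow_mul two_pos.le, ← Real.rpow_mul two_pos.le, ← Real.rpow_add two_pos]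
        congr 1
        push_cast
        field_simp
        ring

end CubeColorings

section Propagation

/-- A binary colouring of the four letters using each colour twice. -/
def IsBalancedLine (ℓ : Fin 4 → Bool) : Prop :=
  (Finset.univ.filter fun a => ℓ a = true).card = 2

instance (ℓ : Fin 4 → Bool) : Decidable (IsBalancedLine ℓ) :=
  inferInstanceAs (Decidable (_ = _))

lemma IsBalancedLine.exists_eq : ∀ {ℓ : Fin 4 → Bool}, IsBalancedLine ℓ → ∀ a,
    ∃ b, b ≠ a ∧ ℓ b = ℓ a := by
  decide

lemma IsBalancedLine.eq_of_eq_on_compl : ∀ {ℓ ℓ' : Fin 4 → Bool}, IsBalancedLine ℓ →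
    IsBalancedLine ℓ' → ∀ {a}, (∀ b, b ≠ a → ℓ b = ℓ' b) → ℓ = ℓ' := by
  decide

lemma IsBalancedLine.eq_of_pairs_eq : ∀ {ℓ ℓ' : Fin 4 → Bool}, IsBalancedLine ℓ →
    IsBalancedLine ℓ' → ∀ {a c}, a ≠ c → ℓ a = ℓ c ∧ ℓ' a = ℓ' c ∧ ℓ a = ℓ' a → ℓ = ℓ' := by
  decide

variable {X X' : Type*} {H : SimpleGraph X} {H' : SimpleGraph X'} {ι : Fin 4 → X → X'}
  {φ φ' : X' → Bool} {K : Set X'}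

/-- The set `K` contains every vertex that is adjacent to a vertex of `K` of the same colour, i.e.
it is a union of monochromatic components. -/
def ColorClosed (H : SimpleGraph X) (φ : X → Bool) (K : Set X) : Prop :=
  ∀ x ∈ K, ∀ y, H.Adj x y → φ y = φ x → y ∈ K

/-- Two colourings of the class `𝒞` are equal as soon as they agree on a common nonempty union of
monochromatic components. -/
def Propagates (H : SimpleGraph X) (𝒞 : Set (X → Bool)) : Prop :=
  ∀ φ ∈ 𝒞, ∀ φ' ∈ 𝒞, ∀ K : Set X, K.Nonempty → ColorClosed H φ K → ColorClosed H φ' K →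
    Set.EqOn φ φ' K → φ = φ'

lemma ColorClosed.comap (f : H →g H') (hK : ColorClosed H' φ K) :
    ColorClosed H (φ ∘ f) (f ⁻¹' K) :=
  fun x hx _ h he => hK (f x) hx _ (f.map_adj h) he

lemma Propagates.of_surjective {𝒞 : Set (X → Bool)} {𝒞' : Set (X' → Bool)}
    (h𝒞 : Propagates H 𝒞) (f : H →g H') (hf : Surjective f) (hmem : ∀ φ ∈ 𝒞', φ ∘ f ∈ 𝒞) :
    Propagates H' 𝒞' := fun φ hφ φ' hφ' K hne hK hK' heq =>
  hf.injective_comp_right <| h𝒞 _ (hmem φ hφ) _ (hmem φ' hφ') (f ⁻¹' K) (hne.preimage hf)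
    (hK.comap f) (hK'.comap f) fun _ hx => heq hx

/-- The four maps `ι a` embed `H` into `H'` as parallel layers: they cover `H'`, and the four images
of a vertex are pairwise adjacent. -/
structure IsLayering (H : SimpleGraph X) (H' : SimpleGraph X') (ι : Fin 4 → X → X') : Prop where
  map_adj : ∀ a {x y}, H.Adj x y → H'.Adj (ι a x) (ι a y)
  adj_of_ne : ∀ {a b} x, a ≠ b → H'.Adj (ι a x) (ι b x)
  exists_eq : ∀ z, ∃ a x, ι a x = z

lemma IsLayering.funext (hι : IsLayering H H' ι)
    (h : ∀ x, (fun a => φ (ι a x)) = fun a => φ' (ι a x)) : φ = φ' := by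
  funext z
  obtain ⟨a, x, rfl⟩ := hι.exists_eq z
  exact congrFun (h x) a

lemma ColorClosed.layer (hι : IsLayering H H' ι) (hK : ColorClosed H' φ K) (a : Fin 4) :
    ColorClosed H (φ ∘ ι a) (ι a ⁻¹' K) :=
  hK.comap ⟨ι a, hι.map_adj a⟩

lemma ColorClosed.exists_mem_layer (hι : IsLayering H H' ι) (hK : ColorClosed H' φ K)
    {a : Fin 4} {x : X} (hφ : IsBalancedLine fun a => φ (ι a x)) (hx : ι a x ∈ K) :
    ∃ b, b ≠ a ∧ φ (ι b x) = φ (ι a x) ∧ ι b x ∈ K := by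
  obtain ⟨b, hba, hb⟩ := hφ.exists_eq a
  exact ⟨b, hba, hb, hK _ hx _ (hι.adj_of_ne x hba.symm) hb⟩

lemma Propagates.layers_eq (hι : IsLayering H H' ι) {𝒞 : Set (X → Bool)} (h𝒞 : Propagates H 𝒞)
    (hmem : ∀ a, φ ∘ ι a ∈ 𝒞) (hline : ∀ x, IsBalancedLine fun a => φ (ι a x))
    (hK : ColorClosed H' φ K) {a c : Fin 4} (ha : (ι a ⁻¹' K).Nonempty)
    (hac : ∀ b, (ι b ⁻¹' K).Nonempty → b = a ∨ b = c) : φ ∘ ι a = φ ∘ ι c := by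
  have hswap : ∀ {b e : Fin 4}, (∀ i, (ι i ⁻¹' K).Nonempty → i = b ∨ i = e) →
      ∀ x ∈ ι b ⁻¹' K, φ (ι e x) = φ (ι b x) ∧ x ∈ ι e ⁻¹' K := fun {b e} hbe x hx => by
    obtain ⟨i, hib, hi, hiK⟩ := hK.exists_mem_layer hι (hline x) hx
    obtain rfl := (hbe i ⟨x, hiK⟩).resolve_left hib
    exact ⟨hi, hiK⟩
  have hlayer : ι c ⁻¹' K = ι a ⁻¹' K := Set.Subset.antisymm
    (fun x hx => (hswap (fun b hb => (hac b hb).symm) x hx).2) fun x hx => (hswap hac x hx).2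
  exact h𝒞 _ (hmem a) _ (hmem c) _ ha (hK.layer hι a) (hlayer ▸ hK.layer hι c)
    fun x hx => (hswap hac x hx).1.symm

/-- If the union of components meets three layers, then these determine the fourth by balance; if
it meets only two, then both colourings repeat themselves on these two layers. -/
lemma Propagates.of_isLayering (hι : IsLayering H H' ι) {𝒞 : Set (X → Bool)}
    {𝒞' : Set (X' → Bool)} (h𝒞 : Propagates H 𝒞) (hmem : ∀ φ ∈ 𝒞', ∀ a, φ ∘ ι a ∈ 𝒞)
    (hline : ∀ φ ∈ 𝒞', ∀ x, IsBalancedLine fun a => φ (ι a x)) : Propagates H' 𝒞' := by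
  intro φ hφ φ' hφ' K ⟨z, hz⟩ hK hK' heq
  have hagree : ∀ b, (ι b ⁻¹' K).Nonempty → φ ∘ ι b = φ' ∘ ι b := fun b hb =>
    h𝒞 _ (hmem φ hφ b) _ (hmem φ' hφ' b) _ hb (hK.layer hι b) (hK'.layer hι b) fun _ hx => heq hx
  obtain ⟨a, x, rfl⟩ := hι.exists_eq z
  obtain ⟨c, hca, -, hc⟩ := hK.exists_mem_layer hι (hline φ hφ x) hz
  have ha : (ι a ⁻¹' K).Nonempty := ⟨x, hz⟩
  refine hι.funext fun y => ?_
  by_cases htwo : ∀ b, (ι b ⁻¹' K).Nonempty → b = a ∨ b = c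
  · exact (hline φ hφ y).eq_of_pairs_eq (hline φ' hφ' y) hca.symm
      ⟨congrFun (h𝒞.layers_eq hι (hmem φ hφ) (hline φ hφ) hK ha htwo) y,
        congrFun (h𝒞.layers_eq hι (hmem φ' hφ') (hline φ' hφ') hK' ha htwo) y,
        congrFun (hagree a ha) y⟩
  · push Not at htwo
    obtain ⟨b, hb, hba, hbc⟩ := htwo
    have hfourth : ∀ {a b c : Fin 4}, c ≠ a → b ≠ a → b ≠ c →
        ∃ e, ∀ i, i ≠ e → i = a ∨ i = b ∨ i = c := by decide
    obtain ⟨e, he⟩ := hfourth hca hba hbc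
    refine (hline φ hφ y).eq_of_eq_on_compl (hline φ' hφ' y) (a := e) fun i hi => ?_
    rcases he i hi with rfl | rfl | rfl
    exacts [congrFun (hagree _ ha) y, congrFun (hagree _ hb) y, congrFun (hagree _ ⟨x, hc⟩) y]

end Propagation

section Sparse

/-- The colourings of the words with two letters of each colour on every line. -/
def balancedFunctions (k : ℕ) : Set (Word k → Bool) :=
  {φ | ∀ x i, IsBalancedLine fun c => φ (update x i c)}

variable {k : ℕ}

lemma comp_prepend_mem_balancedFunctions {φ : Word (k + 1) → Bool}
    (hφ : φ ∈ balancedFunctions (k + 1)) (a : Fin 4) : φ ∘ prepend a ∈ balancedFunctions k :=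
  fun x i => by simpa [Fin.cons_update] using hφ (prepend a x) i.succ

lemma isBalancedLine_prepend {φ : Word (k + 1) → Bool} (hφ : φ ∈ balancedFunctions (k + 1))
    (x : Word k) : IsBalancedLine fun a => φ (prepend a x) := by
  simpa [Fin.update_cons_zero] using hφ (prepend 0 x) 0

lemma isLayering_prepend (k : ℕ) :
    IsLayering (hammingGraph k) (hammingGraph (k + 1)) prepend where
  map_adj a x y h := by
    obtain ⟨i, c, hc, rfl⟩ := hammingGraph_adj_iff.1 h
    exact hammingGraph_adj_iff.2 ⟨i.succ, c, by simpa using hc, by simp [Fin.cons_update]⟩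
  adj_of_ne {a b} x h := hammingGraph_adj_iff.2 ⟨0, b, h.symm, by simp [Fin.update_cons_zero]⟩
  exists_eq := exists_prepend_eq

lemma propagates_balancedFunctions (k : ℕ) : Propagates (hammingGraph k) (balancedFunctions k) := by
  induction k with
  | zero =>
    intro φ _ φ' _ K ⟨z, hz⟩ _ _ heq
    funext y
    rw [Subsingleton.elim y z, heq hz]
  | succ k ih =>
    exact ih.of_isLayering (isLayering_prepend k)
      (fun φ hφ => comp_prepend_mem_balancedFunctions hφ) fun φ hφ => isBalancedLine_prepend hφ

lemma ColorClosed.two_pow_le_ncard {φ : Word k → Bool} (hφ : φ ∈ balancedFunctions k)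
    {K : Set (Word k)} (hK : ColorClosed (hammingGraph k) φ K) (hne : K.Nonempty) :
    2 ^ k ≤ K.ncard :=
  _root_.two_pow_le_ncard hne fun y hy i => by
    obtain ⟨c, hc, h⟩ := (hφ y i).exists_eq (y i)
    exact ⟨c, hc, hK y hy _ (hammingGraph_adj_update hc) (by rwa [update_eq_self] at h)⟩

lemma sum_ncard_prepend_preimage (K : Set (Word (k + 1))) :
    ∑ a, (prepend a ⁻¹' K).ncard = K.ncard := by
  have hK : K = ⋃ a, prepend a '' (prepend a ⁻¹' K) := by
    ext z
    obtain ⟨a, y, rfl⟩ := exists_prepend_eq z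
    simp [Fin.cons_inj]
  have hdisj : Pairwise (Disjoint on fun a => prepend a '' (prepend a ⁻¹' K)) := fun a b hab => by
    refine Set.disjoint_left.2 ?_
    rintro _ ⟨x, -, rfl⟩ ⟨y, -, hy⟩
    exact hab (by simpa using (congrFun hy 0).symm)
  conv_rhs => rw [hK, Set.ncard_iUnion_of_finite (fun _ => Set.toFinite _) hdisj,
    finsum_eq_sum_of_fintype]
  exact Finset.sum_congr rfl fun a _ => (Set.ncard_image_of_injective _ (prepend_injective a)).symm

/-- The balanced functions with a monochromatic union of components of size at most `b * 2 ^ k / 2`.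
Every such union has at least `2 ^ k` elements, so `b` measures the deviation from this minimum. -/
def sparseFunctions (k b : ℕ) : Set (Word k → Bool) :=
  {φ ∈ balancedFunctions k | ∃ K : Set (Word k), K.Nonempty ∧ ColorClosed (hammingGraph k) φ K ∧
    2 * K.ncard ≤ b * 2 ^ k}

lemma sparseFunctions_zero_right (k : ℕ) : sparseFunctions k 0 = ∅ :=
  Set.eq_empty_of_forall_notMem fun _ ⟨hφ, _, hne, hK, hcard⟩ => by
    have := hK.two_pow_le_ncard hφ hne
    have := Nat.two_pow_pos k
    omega

lemma ColorClosed.two_mul_ncard_preimage_le {φ : Word (k + 1) → Bool}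
    (hφ : φ ∈ balancedFunctions (k + 1)) {K : Set (Word (k + 1))}
    (hK : ColorClosed (hammingGraph (k + 1)) φ K) (a : Fin 4) :
    2 * (prepend a ⁻¹' K).ncard ≤ K.ncard := by
  have hsub : prepend a ⁻¹' K ⊆ ⋃ b : {b // b ≠ a}, prepend b.1 ⁻¹' K := fun x hx => by
    obtain ⟨b, hba, -, hb⟩ :=
      hK.exists_mem_layer (isLayering_prepend k) (isBalancedLine_prepend hφ x) hx
    exact Set.mem_iUnion.2 ⟨⟨b, hba⟩, hb⟩
  have hle := (Set.ncard_le_ncard hsub (Set.toFinite _)).trans (Set.ncard_iUnion_le_of_fintype _)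
  rw [← sum_ncard_prepend_preimage K, two_mul, Fintype.sum_eq_add_sum_subtype_ne _ a]
  exact Nat.add_le_add_left hle _

lemma ColorClosed.two_mul_ncard_preimage_le_or {φ : Word (k + 1) → Bool}
    (hφ : φ ∈ balancedFunctions (k + 1)) {K : Set (Word (k + 1))}
    (hK : ColorClosed (hammingGraph (k + 1)) φ K) {b : ℕ}
    (hcard : 2 * K.ncard ≤ (b + 1) * 2 ^ (k + 1)) {i j l : Fin 4} (hij : i ≠ j) (hil : i ≠ l)
    (hjl : j ≠ l) (hl : (prepend l ⁻¹' K).Nonempty) :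
    2 * (prepend i ⁻¹' K).ncard ≤ b * 2 ^ k ∨ 2 * (prepend j ⁻¹' K).ncard ≤ b * 2 ^ k := by
  have hl' := (hK.layer (isLayering_prepend k) l).two_pow_le_ncard
    (comp_prepend_mem_balancedFunctions hφ l) hl
  have hsum : ∑ u ∈ {i, j, l}, (prepend u ⁻¹' K).ncard ≤ K.ncard :=
    (Finset.sum_le_sum_of_subset (Finset.subset_univ _)).trans (sum_ncard_prepend_preimage K).le
  rw [Finset.sum_insert (by simp [hij, hil]), Finset.sum_pair hjl] at hsum
  rw [pow_succ] at hcard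
  lia

/-- A sparse function either repeats a sparse layer or has three sparse layers, two of which are
sparser: two layers of size above `b * 2 ^ k / 2` leave no room for a third one. -/
lemma sparseFunctions_succ_cases {b : ℕ} {φ : Word (k + 1) → Bool}
    (hφ : φ ∈ sparseFunctions (k + 1) (b + 1)) :
    (∃ a c, a ≠ c ∧ φ ∘ prepend a = φ ∘ prepend c ∧ φ ∘ prepend a ∈ sparseFunctions k (b + 1)) ∨
      ∃ a c e, a ≠ c ∧ a ≠ e ∧ c ≠ e ∧ φ ∘ prepend a ∈ sparseFunctions k b ∧
        φ ∘ prepend c ∈ sparseFunctions k b ∧ φ ∘ prepend e ∈ sparseFunctions k (b + 1) := by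
  obtain ⟨hφ, K, ⟨z, hz⟩, hK, hcard⟩ := hφ
  have hι := isLayering_prepend k
  have hmem := comp_prepend_mem_balancedFunctions hφ
  have hlarge : ∀ a, (prepend a ⁻¹' K).Nonempty → φ ∘ prepend a ∈ sparseFunctions k (b + 1) :=
    fun a ha => ⟨hmem a, _, ha, hK.layer hι a, by
      have := hK.two_mul_ncard_preimage_le hφ a
      rw [pow_succ] at hcard
      lia⟩
  obtain ⟨a, x, rfl⟩ := exists_prepend_eq z
  obtain ⟨c, hca, -, hc⟩ := hK.exists_mem_layer hι (isBalancedLine_prepend hφ x) hz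
  have ha : (prepend a ⁻¹' K).Nonempty := ⟨x, hz⟩
  by_cases htwo : ∀ b, (prepend b ⁻¹' K).Nonempty → b = a ∨ b = c
  · exact .inl ⟨a, c, hca.symm, (propagates_balancedFunctions k).layers_eq hι hmem
      (isBalancedLine_prepend hφ) hK ha htwo, hlarge a ha⟩
  push Not at htwo
  obtain ⟨e, he, hea, hec⟩ := htwo
  have hsmall : ∀ {i j l}, i ≠ j → i ≠ l → j ≠ l → (prepend i ⁻¹' K).Nonempty →
      (prepend j ⁻¹' K).Nonempty → (prepend l ⁻¹' K).Nonempty →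
      φ ∘ prepend i ∈ sparseFunctions k b ∨ φ ∘ prepend j ∈ sparseFunctions k b :=
    fun {i j l} hij hil hjl hi hj hl =>
      (hK.two_mul_ncard_preimage_le_or hφ hcard hij hil hjl hl).imp
        (fun h => ⟨hmem i, _, hi, hK.layer hι i, h⟩) fun h => ⟨hmem j, _, hj, hK.layer hι j, h⟩
  have hc : (prepend c ⁻¹' K).Nonempty := ⟨x, hc⟩
  refine .inr ?_
  rcases hsmall hca.symm hea.symm hec.symm ha hc he with hsa | hsc
  · rcases hsmall hec.symm hca hea hc he ha with hsc | hse
    exacts [⟨a, c, e, hca.symm, hea.symm, hec.symm, hsa, hsc, hlarge e he⟩,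
      ⟨a, e, c, hea.symm, hca.symm, hec, hsa, hse, hlarge c hc⟩]
  · rcases hsmall hea.symm hca.symm hec ha he hc with hsa | hse
    exacts [⟨a, c, e, hca.symm, hea.symm, hec.symm, hsa, hsc, hlarge e he⟩,
      ⟨c, e, a, hec.symm, hca, hea, hsc, hse, hlarge a ha⟩]

end Sparse

section SparseCount

variable {k : ℕ}

lemma ncard_sparseFunctions_layers_eq_le (k b : ℕ) (a c : Fin 4) :
    {φ ∈ balancedFunctions (k + 1) | a ≠ c ∧ φ ∘ prepend a = φ ∘ prepend c ∧
      φ ∘ prepend a ∈ sparseFunctions k b}.ncard ≤ (sparseFunctions k b).ncard := by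
  refine Set.ncard_le_ncard_of_injOn (· ∘ prepend a) (fun φ hφ => hφ.2.2.2) ?_
  rintro φ ⟨hφ, hac, heq, -⟩ φ' ⟨hφ', -, heq', -⟩ h
  exact (isLayering_prepend k).funext fun x => (isBalancedLine_prepend hφ x).eq_of_pairs_eq
    (isBalancedLine_prepend hφ' x) hac ⟨congrFun heq x, congrFun heq' x, congrFun h x⟩

lemma ncard_three_sparse_layers_le (k b : ℕ) (a c e : Fin 4) :
    {φ ∈ balancedFunctions (k + 1) | (a ≠ c ∧ a ≠ e ∧ c ≠ e) ∧ φ ∘ prepend a ∈ sparseFunctions k b ∧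
      φ ∘ prepend c ∈ sparseFunctions k b ∧ φ ∘ prepend e ∈ sparseFunctions k (b + 1)}.ncard ≤
    (sparseFunctions k b).ncard ^ 2 * (sparseFunctions k (b + 1)).ncard := by
  rw [sq, mul_assoc, ← Set.ncard_prod, ← Set.ncard_prod]
  refine Set.ncard_le_ncard_of_injOn
    (fun φ => (φ ∘ prepend a, φ ∘ prepend c, φ ∘ prepend e)) (fun φ hφ => hφ.2.2) ?_
  rintro φ ⟨hφ, hdist, -⟩ φ' ⟨hφ', -⟩ h
  simp only [Prod.mk.injEq] at h
  have hfourth : ∀ {a c e : Fin 4}, a ≠ c ∧ a ≠ e ∧ c ≠ e →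
      ∃ u, ∀ i, i ≠ u → i = a ∨ i = c ∨ i = e := by decide
  obtain ⟨u, hu⟩ := hfourth hdist
  refine (isLayering_prepend k).funext fun x => (isBalancedLine_prepend hφ x).eq_of_eq_on_compl
    (isBalancedLine_prepend hφ' x) (a := u) fun i hi => ?_
  rcases hu i hi with rfl | rfl | rfl
  exacts [congrFun h.1 x, congrFun h.2.1 x, congrFun h.2.2 x]

lemma ncard_sparseFunctions_succ_le (k b : ℕ) : (sparseFunctions (k + 1) (b + 1)).ncard ≤
    16 * (sparseFunctions k (b + 1)).ncard +
      64 * ((sparseFunctions k b).ncard ^ 2 * (sparseFunctions k (b + 1)).ncard) := by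
  have hsub : sparseFunctions (k + 1) (b + 1) ⊆
      (⋃ p : Fin 4 × Fin 4, {φ ∈ balancedFunctions (k + 1) | p.1 ≠ p.2 ∧
        φ ∘ prepend p.1 = φ ∘ prepend p.2 ∧ φ ∘ prepend p.1 ∈ sparseFunctions k (b + 1)}) ∪
      ⋃ p : Fin 4 × Fin 4 × Fin 4, {φ ∈ balancedFunctions (k + 1) |
        (p.1 ≠ p.2.1 ∧ p.1 ≠ p.2.2 ∧ p.2.1 ≠ p.2.2) ∧ φ ∘ prepend p.1 ∈ sparseFunctions k b ∧
        φ ∘ prepend p.2.1 ∈ sparseFunctions k b ∧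
        φ ∘ prepend p.2.2 ∈ sparseFunctions k (b + 1)} := fun φ hφ => by
    rcases sparseFunctions_succ_cases hφ with ⟨a, c, h⟩ | ⟨a, c, e, hac, hae, hce, h⟩
    · exact .inl (Set.mem_iUnion.2 ⟨(a, c), hφ.1, h⟩)
    · exact .inr (Set.mem_iUnion.2 ⟨(a, c, e), hφ.1, ⟨hac, hae, hce⟩, h⟩)
  refine (Set.ncard_le_ncard hsub (Set.toFinite _)).trans
    ((Set.ncard_union_le _ _).trans (Nat.add_le_add ?_ ?_)) <;>
  refine (Set.ncard_iUnion_le_of_fintype _).trans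
    ((Finset.sum_le_card_nsmul _ _ _ fun p _ => ?_).trans_eq (nsmul_eq_mul _ _))
  exacts [ncard_sparseFunctions_layers_eq_le k _ _ _, ncard_three_sparse_layers_le k b _ _ _]

lemma ncard_sparseFunctions_le (k b : ℕ) :
    (sparseFunctions k b).ncard ≤ 2 ^ (9 * (k + 1)) ^ b := by
  induction k generalizing b with
  | zero =>
    calc _ ≤ Nat.card (Word 0 → Bool) := Set.ncard_le_card _
      _ = 2 ^ 1 := by simp
      _ ≤ _ := Nat.pow_le_pow_right two_pos (Nat.one_le_pow _ _ (by lia))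
  | succ k ih =>
    obtain _ | b := b
    · simp [sparseFunctions_zero_right]
    set p := (9 * (k + 1)) ^ b
    set q := (9 * (k + 1)) ^ (b + 1)
    have hp : 1 ≤ p := Nat.one_le_pow _ _ (by lia)
    have hexp : q + 9 * p ≤ (9 * (k + 1 + 1)) ^ (b + 1) := by
      calc q + 9 * p = p * (9 * (k + 1 + 1)) := by simp only [q, p, pow_succ]; ring
        _ ≤ (9 * (k + 1 + 1)) ^ b * (9 * (k + 1 + 1)) := by
          simp only [p]
          gcongr
          lia
        _ = _ := (pow_succ _ _).symm
    calc _ ≤ 16 * 2 ^ q + 64 * ((2 ^ p) ^ 2 * 2 ^ q) := by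
          refine (ncard_sparseFunctions_succ_le k b).trans ?_
          gcongr <;> exact ih _
      _ ≤ 64 * ((2 ^ p) ^ 2 * 2 ^ q) + 64 * ((2 ^ p) ^ 2 * 2 ^ q) := by
          gcongr
          · norm_num
          · exact Nat.le_mul_of_pos_left _ (by positivity)
      _ = 2 ^ (7 + (p * 2 + q)) := by rw [pow_add, pow_add, pow_mul]; ring
      _ ≤ _ := Nat.pow_le_pow_right two_pos (by lia)

end SparseCount

section Nice

variable {d : ℕ} {f g : Word (d + 1) → Fin 4} {P : Pair}

lemma IsLatin.pairList_mem_balancedFunctions (hf : IsLatin f) (t : Fin (d + 1)) (P : Pair)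
    (v : Fin 4) : (fun y => pairList f t P.1 y v) ∈ balancedFunctions d := fun x i => by
  have hbij : ∀ a, Bijective fun c => f (insertLetter t a (update x i c)) := fun a => by
    rw [← Finite.injective_iff_bijective]
    simpa [Fin.insertNth_update] using hf (insertLetter t a x) (t.succAbove i)
  choose r hr using fun a => (hbij a).surjective v
  have hr_inj : Injective r := fun a b hab =>
    hf.injective_insertLetter t (update x i (r a)) ((hr a).trans (hab ▸ (hr b).symm))
  refine (congrArg Finset.card ?_).trans ((Finset.card_image_of_injective P.1 hr_inj).trans P.2)
  ext c
  simp only [pairList, decide_eq_true_eq, Finset.mem_filter_univ, Finset.mem_image]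
  refine exists_congr fun a => and_congr_right fun _ => ⟨fun h => ?_, fun h => ?_⟩
  · exact (hbij a).injective ((hr a).trans h.symm)
  · exact h ▸ hr a

lemma colorClosed_compSet (L : Word d → Fin 4 → Bool) (v : Fin 4)
    (c : ((linkGraph L).induce Set.univ).ConnectedComponent) :
    ColorClosed (hammingGraph d) (fun y => L y v) (compSet c) := fun _ hx _ hadj h =>
  mem_compSet_of_adj hx (Set.mem_univ _) ⟨hadj, v, h.symm⟩

/-- If the link graph has many components, one of them is small. -/
lemma IsLatin.pairList_mem_sparseFunctions (hf : IsLatin f) {s : ℕ} (t : Fin (d + 1)) (P : Pair)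
    (hs : 2 ^ d ≤ s * compCount (linkGraph (pairList f t P.1)) Set.univ) (v : Fin 4) :
    (fun y => pairList f t P.1 y v) ∈ sparseFunctions d (2 * s) := by
  obtain ⟨c, hc⟩ :=
    exists_compCount_mul_ncard_le (G := linkGraph (pairList f t P.1)) Set.univ_nonempty
  refine ⟨hf.pairList_mem_balancedFunctions t P v, compSet c, compSet_nonempty c,
    colorClosed_compSet _ v c, ?_⟩
  have hcard : (Set.univ : Set (Word d)).ncard = 2 ^ d * 2 ^ d := by
    simp [Set.ncard_univ, ← mul_pow]
  have hK : 2 ^ d * (compSet c).ncard ≤ 2 ^ d * (s * 2 ^ d) :=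
    calc _ ≤ s * compCount _ _ * (compSet c).ncard := Nat.mul_le_mul_right _ hs
      _ = s * (compCount _ _ * (compSet c).ncard) := mul_assoc _ _ _
      _ ≤ s * (2 ^ d * 2 ^ d) := Nat.mul_le_mul_left s (hcard ▸ hc)
      _ = _ := by ring
  have := Nat.le_of_mul_le_mul_left hK (Nat.two_pow_pos d)
  lia

lemma ncard_domRestrict_slab_compl_le (hf : IsLatin f) (P : Pair)
    {𝒢 : Set (Word (d + 1) → Fin 4)}
    (h𝒢 : ∀ g ∈ 𝒢, IsLatin g ∧ pairList g 0 P.1 = pairList f 0 P.1) :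
    ((slab 0 P.1ᶜ Set.univ).domRestrict '' 𝒢).ncard ≤
      2 ^ compCount (linkGraph (pairList f 0 P.1)) Set.univ := by
  have := ncard_domRestrict_slab_le 0 P.compl Set.univ hf (s := 𝒢) fun g hg =>
    ⟨(h𝒢 g hg).1, fun y _ => by
      funext v
      simp only [Pair.compl, pairList_compl hf, pairList_compl (h𝒢 g hg).1, (h𝒢 g hg).2]⟩
  rwa [Pair.compl, linkGraph_pairList_compl hf] at this

lemma eq_of_eqOn_slab {P : Finset (Fin 4)}
    (h : (slab 0 P Set.univ).domRestrict f = (slab 0 P Set.univ).domRestrict g)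
    (h' : (slab 0 Pᶜ Set.univ).domRestrict f = (slab 0 Pᶜ Set.univ).domRestrict g) : f = g := by
  rw [Set.domRestrict_eq_domRestrict_iff] at h h'
  funext z
  by_cases hz : z 0 ∈ P
  · exact h ⟨hz, trivial⟩
  · exact h' ⟨Finset.mem_compl.2 hz, trivial⟩

lemma ncard_pairList_eq_le (hf : IsLatin f) (P : Pair) :
    {g ∈ latinSet (d + 1) | pairList g 0 P.1 = pairList f 0 P.1}.ncard ≤ 2 ^ 2 ^ (d + 1) := by
  set 𝒢 := {g ∈ latinSet (d + 1) | pairList g 0 P.1 = pairList f 0 P.1}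
  have hcomp := Nat.pow_le_pow_right two_pos (hf.hasPartners_linkGraph 0 P).compCount_le
  have hfibre : ∀ g ∈ 𝒢, ((slab 0 P.1ᶜ Set.univ).domRestrict '' {g' ∈ 𝒢 |
      (slab 0 P.1 Set.univ).domRestrict g' = (slab 0 P.1 Set.univ).domRestrict g}).ncard ≤
        2 ^ 2 ^ d := fun _ _ =>
    (ncard_domRestrict_slab_compl_le hf P fun g' hg' => hg'.1).trans hcomp
  have hslab := (ncard_domRestrict_slab_le 0 P Set.univ hf (s := 𝒢)
    fun g hg => ⟨hg.1, fun y _ => congrFun hg.2 y⟩).trans hcomp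
  calc 𝒢.ncard = (id '' 𝒢).ncard := by rw [Set.image_id]
    _ ≤ 2 ^ 2 ^ d * ((slab 0 P.1 Set.univ).domRestrict '' 𝒢).ncard :=
      ncard_image_le_mul 𝒢 _ (fun _ _ _ _ => eq_of_eqOn_slab) hfibre
    _ ≤ 2 ^ 2 ^ d * 2 ^ 2 ^ d := Nat.mul_le_mul_left _ hslab
    _ = 2 ^ 2 ^ (d + 1) := by rw [← pow_add, ← two_mul, ← pow_succ']

/-- Some link graph of `f` along the first coordinate has at least `2 ^ d / s` components. -/
def IsNice (s : ℕ) (f : Word (d + 1) → Fin 4) : Prop :=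
  ∃ P : Pair, 2 ^ d ≤ s * compCount (linkGraph (pairList f 0 P.1)) Set.univ

lemma ncard_nice_pair_le (s d : ℕ) (P : Pair) :
    {f ∈ latinSet (d + 1) |
      2 ^ d ≤ s * compCount (linkGraph (pairList f 0 P.1)) Set.univ}.ncard ≤
    2 ^ 2 ^ (d + 1) * (2 ^ (9 * (d + 1)) ^ (2 * s)) ^ 4 := by
  set 𝒩 := {f ∈ latinSet (d + 1) |
    2 ^ d ≤ s * compCount (linkGraph (pairList f 0 P.1)) Set.univ}
  have hcolumns : ((fun f v y => pairList f 0 P.1 y v) '' 𝒩).ncard ≤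
      (2 ^ (9 * (d + 1)) ^ (2 * s)) ^ 4 :=
    calc _ ≤ (Set.univ.pi fun _ : Fin 4 => sparseFunctions d (2 * s)).ncard := by
          refine Set.ncard_le_ncard ?_ (Set.toFinite _)
          rintro _ ⟨f, hf, rfl⟩ v -
          exact IsLatin.pairList_mem_sparseFunctions hf.1 0 P hf.2 v
      _ = (sparseFunctions d (2 * s)).ncard ^ 4 := by
          rw [← Nat.card_coe_set_eq, Nat.card_congr (Equiv.Set.univPi _), Nat.card_pi]
          simp
      _ ≤ _ := Nat.pow_le_pow_left (ncard_sparseFunctions_le d (2 * s)) 4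
  refine (ncard_le_mul_ncard_image 𝒩 fun f hf => ?_).trans (Nat.mul_le_mul_left _ hcolumns)
  refine (Set.ncard_le_ncard (fun g hg => ?_) (Set.toFinite _)).trans (ncard_pairList_eq_le hf.1 P)
  exact ⟨hg.1.1, funext₂ fun y v => congrFun₂ hg.2 v y⟩

lemma ncard_nice_le (s d : ℕ) : {f ∈ latinSet (d + 1) | IsNice s f}.ncard ≤
    6 * (2 ^ 2 ^ (d + 1) * (2 ^ (9 * (d + 1)) ^ (2 * s)) ^ 4) := by
  have hsub : {f ∈ latinSet (d + 1) | IsNice s f} ⊆ ⋃ P : Pair, {f ∈ latinSet (d + 1) |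
      2 ^ d ≤ s * compCount (linkGraph (pairList f 0 P.1)) Set.univ} :=
    fun f ⟨hf, P, hP⟩ => Set.mem_iUnion.2 ⟨P, hf, hP⟩
  have hcard : Fintype.card Pair = 6 := by decide
  refine (Set.ncard_le_ncard hsub (Set.toFinite _)).trans
    ((Set.ncard_iUnion_le_of_fintype _).trans ?_)
  refine (Finset.sum_le_card_nsmul _ _ _ fun P _ => ncard_nice_pair_le s d P).trans_eq ?_
  rw [Finset.card_univ, hcard, smul_eq_mul]

lemma ncard_not_nice_layers_le {s : ℕ} (hs : s ≠ 0) {a b : Fin 4} (hab : a ≠ b)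
    (φ ψ : Word d → Fin 4) :
    {f ∈ latinSet (d + 1) | ¬IsNice s f ∧ f ∘ prepend a = φ ∧ f ∘ prepend b = ψ}.ncard ≤
      2 ^ (2 ^ d / s) := by
  set 𝒢 := {f ∈ latinSet (d + 1) | ¬IsNice s f ∧ f ∘ prepend a = φ ∧ f ∘ prepend b = ψ}
  obtain h | ⟨f, hf, hnice, hfa, hfb⟩ := 𝒢.eq_empty_or_nonempty
  · simp [h]
  let P : Pair := ⟨{a, b}, Finset.card_pair hab⟩
  have hagree : ∀ g ∈ 𝒢, ∀ y, ∀ e ∈ P.1, g (prepend e y) = f (prepend e y) := fun g hg y e he => by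
    obtain rfl | rfl : e = a ∨ e = b := by simpa [P] using he
    exacts [congrFun (hg.2.2.1.trans hfa.symm) y, congrFun (hg.2.2.2.trans hfb.symm) y]
  have hlist : ∀ g ∈ 𝒢, IsLatin g ∧ pairList g 0 P.1 = pairList f 0 P.1 := fun g hg => by
    refine ⟨hg.1, funext₂ fun y v => ?_⟩
    simp only [pairList, decide_eq_decide, insertLetter, Fin.insertNth_zero']
    exact exists_congr fun e => and_congr_right fun he => by rw [hagree g hg y e he]
  have hcomp : compCount (linkGraph (pairList f 0 P.1)) Set.univ ≤ 2 ^ d / s := by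
    rw [Nat.le_div_iff_mul_le (Nat.pos_of_ne_zero hs), mul_comm]
    exact (not_le.1 fun h => hnice ⟨P, h⟩).le
  calc 𝒢.ncard = (id '' 𝒢).ncard := by rw [Set.image_id]
    _ ≤ ((slab 0 P.1ᶜ Set.univ).domRestrict '' 𝒢).ncard :=
      ncard_image_le_ncard_image 𝒢 fun g hg g' hg' => eq_of_eqOn_slab <|
        Set.domRestrict_eq_domRestrict_iff.2 <| eqOn_slab fun y _ e he => by
          simpa using (hagree g hg y e he).trans (hagree g' hg' y e he).symm
    _ ≤ _ := ncard_domRestrict_slab_compl_le hf P hlist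
    _ ≤ _ := Nat.pow_le_pow_right two_pos hcomp

/-- No iterated layer in the first `T` coordinates is nice. -/
def IsBad (s : ℕ) : ℕ → ∀ d : ℕ, (Word d → Fin 4) → Prop
  | 0, _, _ => True
  | _ + 1, 0, _ => True
  | T + 1, d + 1, f => ¬IsNice s f ∧ ∀ a, IsBad s T d (f ∘ prepend a)

/-- The number of Latin hypercubes with a nice iterated layer in the first `T` coordinates. -/
noncomputable def notBadCount (s T d : ℕ) : ℕ := {f ∈ latinSet d | ¬IsBad s T d f}.ncard

lemma notBadCount_zero (s d : ℕ) : notBadCount s 0 d = 0 := by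
  simp [notBadCount, IsBad]

lemma IsLatin.comp_prepend (hf : IsLatin f) (a : Fin 4) : IsLatin (f ∘ prepend a) :=
  fun x i => by simpa [Fin.cons_update] using hf (prepend a x) i.succ

lemma notBadCount_succ_le {s : ℕ} (hs : s ≠ 0) (T d : ℕ) : notBadCount s (T + 1) (d + 1) ≤
    6 * (2 ^ 2 ^ (d + 1) * (2 ^ (9 * (d + 1)) ^ (2 * s)) ^ 4) +
      4 * (notBadCount s T d * (latinSet d).ncard * 2 ^ (2 ^ d / s)) := by
  let layered (a : Fin 4) (φ ψ : Word d → Fin 4) : Set (Word (d + 1) → Fin 4) :=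
    {f ∈ latinSet (d + 1) | ¬IsNice s f ∧ f ∘ prepend a = φ ∧ f ∘ prepend (a + 1) = ψ}
  let 𝒟 : Set ((Word d → Fin 4) × (Word d → Fin 4)) :=
    {f ∈ latinSet d | ¬IsBad s T d f} ×ˢ latinSet d
  have : Fintype 𝒟 := Fintype.ofFinite _
  have hsub : {f ∈ latinSet (d + 1) | ¬IsBad s (T + 1) (d + 1) f} ⊆
      {f ∈ latinSet (d + 1) | IsNice s f} ∪ ⋃ (a : Fin 4) (p : 𝒟), layered a p.1.1 p.1.2 := by
    rintro f ⟨hf, hbad⟩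
    by_cases hn : IsNice s f
    · exact .inl ⟨hf, hn⟩
    · simp only [IsBad, not_and, not_forall] at hbad
      obtain ⟨a, ha⟩ := hbad hn
      exact .inr (Set.mem_iUnion₂.2 ⟨a, ⟨(f ∘ prepend a, f ∘ prepend (a + 1)),
        ⟨IsLatin.comp_prepend hf a, ha⟩, IsLatin.comp_prepend hf (a + 1)⟩, hf, hn, rfl, rfl⟩)
  have hlayered : ∀ a, (⋃ p : 𝒟, layered a p.1.1 p.1.2).ncard ≤
      notBadCount s T d * (latinSet d).ncard * 2 ^ (2 ^ d / s) := fun a => by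
    have ha : a ≠ a + 1 := by decide +revert
    refine (Set.ncard_iUnion_le_of_fintype _).trans ((Finset.sum_le_card_nsmul _ _ _
      fun p _ => ncard_not_nice_layers_le hs ha p.1.1 p.1.2).trans_eq ?_)
    rw [smul_eq_mul, Finset.card_univ, notBadCount, ← Set.ncard_prod, ← Nat.card_eq_fintype_card]
    rfl
  refine (Set.ncard_le_ncard hsub (Set.toFinite _)).trans ((Set.ncard_union_le _ _).trans
    (Nat.add_le_add (ncard_nice_le s d) ((Set.ncard_iUnion_le_of_fintype _).trans ?_)))
  exact (Finset.sum_le_card_nsmul _ _ _ fun a _ => hlayered a).trans_eq (by simp)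

lemma compCount_union_le {V : Type*} [Finite V] (G : SimpleGraph V) (s t : Set V) :
    compCount G (s ∪ t) ≤ compCount G s + compCount G t := by
  let p : (G.induce s).ConnectedComponent ⊕ (G.induce t).ConnectedComponent →
      (G.induce (s ∪ t)).ConnectedComponent :=
    Sum.elim (.map (SimpleGraph.induceHomOfLE G Set.subset_union_left).toHom)
      (.map (SimpleGraph.induceHomOfLE G Set.subset_union_right).toHom)
  have hp : Surjective p := fun c => by
    obtain ⟨⟨x, hx | hx⟩, rfl⟩ := c.exists_rep
    exacts [⟨.inl ((G.induce s).connectedComponentMk ⟨x, hx⟩), rfl⟩,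
      ⟨.inr ((G.induce t).connectedComponentMk ⟨x, hx⟩), rfl⟩]
  exact (Nat.card_le_card_of_surjective p hp).trans_eq Nat.card_sum

lemma insertLetter_succ_prepend (t : Fin (d + 1)) (e a : Fin 4) (y : Word d) :
    insertLetter t.succ e (prepend a y) = prepend a (insertLetter t e y) :=
  Fin.insertNth_succ_cons t e a y

lemma linkGraph_pairList_prepend_adj (f : Word (d + 2) → Fin 4) (t : Fin (d + 1))
    (P : Finset (Fin 4)) (a : Fin 4) {y z : Word d}
    (h : (linkGraph (pairList (f ∘ prepend a) t P)).Adj y z) :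
    (linkGraph (pairList f t.succ P)).Adj (prepend a y) (prepend a z) := by
  obtain ⟨hadj, v, hv⟩ := h
  refine ⟨(isLayering_prepend d).map_adj a hadj, v, ?_⟩
  simpa only [pairList, comp_apply, insertLetter_succ_prepend] using hv

lemma stageLoss_zero (f : Word (d + 1) → Fin 4) (Q : Fin (d + 1) → Pair) :
    stageLoss f Q 0 = compCount (linkGraph (pairList f 0 (Q 0).1)) Set.univ := by
  simp [stageLoss, box_zero]

lemma exists_stageLoss_succ_le (f : Word (d + 2) → Fin 4) (Q : Fin (d + 2) → Pair)
    (t : Fin (d + 1)) : ∃ a b, stageLoss f Q t.succ ≤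
      stageLoss (f ∘ prepend a) (Fin.tail Q) t + stageLoss (f ∘ prepend b) (Fin.tail Q) t := by
  obtain ⟨a, b, -, hab⟩ := Finset.card_eq_two.1 (Q 0).2
  have hremove : t.succ.removeNth Q = Fin.cons (Q 0) (t.removeNth (Fin.tail Q)) :=
    funext <| Fin.cases (by simp [Fin.removeNth]) fun i => by simp [Fin.removeNth, Fin.tail]
  have hlayer : ∀ e, compCount (linkGraph (pairList f t.succ (Q t.succ).1))
      (prepend e '' box (t.removeNth (Fin.tail Q)) t) ≤
        stageLoss (f ∘ prepend e) (Fin.tail Q) t := fun e =>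
    compCount_image_le _ ⟨prepend e, linkGraph_pairList_prepend_adj f t _ e⟩ _
  refine ⟨a, b, ?_⟩
  rw [stageLoss, hremove, Fin.val_succ, box_cons, hab, Finset.set_biUnion_insert,
    Finset.set_biUnion_singleton]
  exact (compCount_union_le _ _ _).trans (Nat.add_le_add (hlayer a) (hlayer b))

lemma IsBad.two_mul_stageLoss_zero_le {s T : ℕ} (hf : IsBad s T (d + 1) f)
    (Q : Fin (d + 1) → Pair) (hT : 0 < T) : 2 * (s * stageLoss f Q 0) ≤ 2 ^ (d + 1) := by
  obtain ⟨T, rfl⟩ := Nat.exists_eq_succ_of_ne_zero hT.ne'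
  have := not_le.1 fun h => hf.1 ⟨Q 0, h⟩
  rw [stageLoss_zero, pow_succ']
  lia

lemma IsBad.stageLoss_le {s T : ℕ} (hf : IsBad s T (d + 1) f) (Q : Fin (d + 1) → Pair)
    {t : Fin (d + 1)} (ht : (t : ℕ) < T) : 2 * (s * stageLoss f Q t) ≤ 2 ^ (d + 1) := by
  induction d generalizing T with
  | zero =>
    obtain rfl := Fin.fin_one_eq_zero t
    exact hf.two_mul_stageLoss_zero_le Q ht
  | succ d ih =>
    induction t using Fin.cases with
    | zero => exact hf.two_mul_stageLoss_zero_le Q ht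
    | succ t =>
      obtain _ | T := T
      · exact absurd ht (Nat.not_lt_zero _)
      obtain ⟨a, b, hab⟩ := exists_stageLoss_succ_le f Q t
      have ha := ih (hf.2 a) (Fin.tail Q) (Nat.lt_of_succ_lt_succ ht)
      have hb := ih (hf.2 b) (Fin.tail Q) (Nat.lt_of_succ_lt_succ ht)
      calc _ ≤ 2 * (s * (stageLoss (f ∘ prepend a) (Fin.tail Q) t +
              stageLoss (f ∘ prepend b) (Fin.tail Q) t)) := by gcongr
        _ ≤ 2 ^ (d + 1) + 2 ^ (d + 1) := by rw [mul_add, mul_add]; exact Nat.add_le_add ha hb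
        _ = 2 ^ (d + 1 + 1) := by rw [← two_mul, ← pow_succ']

end Nice

section Asymptotics

variable {a b : ℕ → ℕ} {A B C : ℝ}

/-- `a d ≤ 2 ^ ((C + o(1)) * 2 ^ d)`. -/
def DoubleExpBound (a : ℕ → ℕ) (C : ℝ) : Prop :=
  ∀ C' > C, ∀ᶠ d in atTop, (a d : ℝ) ≤ (2 : ℝ) ^ (C' * 2 ^ d)

lemma DoubleExpBound.mono (ha : DoubleExpBound a A) (hAB : A ≤ B)
    (hba : ∀ d, b (d + 1) ≤ a (d + 1)) : DoubleExpBound b B := fun C' hC' => by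
  filter_upwards [ha C' (hAB.trans_lt hC'), eventually_ge_atTop 1] with d hd hpos
  obtain ⟨d, rfl⟩ := Nat.exists_eq_add_of_le' hpos
  exact (Nat.cast_le.2 (hba d)).trans hd

lemma DoubleExpBound.of_tendsto {e : ℕ → ℝ} (ha : ∀ d, (a d : ℝ) ≤ 2 ^ e d)
    (he : Tendsto (fun d => e d / 2 ^ d) atTop (𝓝 C)) : DoubleExpBound a C := fun C' hC' => by
  filter_upwards [he.eventually_lt_const hC'] with d hd
  rw [div_lt_iff₀ (by positivity)] at hd
  exact (ha d).trans (Real.rpow_le_rpow_of_exponent_le one_le_two hd.le)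

lemma DoubleExpBound.two_pow {e : ℕ → ℕ} (he : ∀ d, (e d : ℝ) ≤ C * 2 ^ d) :
    DoubleExpBound (fun d => 2 ^ e d) C := fun C' hC' => .of_forall fun d => by
  push_cast
  rw [← Real.rpow_natCast]
  exact Real.rpow_le_rpow_of_exponent_le one_le_two ((he d).trans (by gcongr))

lemma tendsto_mul_succ_pow_div_two_pow (c : ℝ) (k : ℕ) :
    Tendsto (fun d : ℕ => c * (d + 1) ^ k / 2 ^ d) atTop (𝓝 0) := by
  have h := ((tendsto_pow_const_div_const_pow_of_one_lt k one_lt_two).comp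
    (tendsto_add_atTop_nat 1)).const_mul (2 * c)
  rw [mul_zero] at h
  refine h.congr fun d => ?_
  simp only [comp_apply, Nat.cast_add, Nat.cast_one, pow_succ]
  field_simp

lemma DoubleExpBound.of_le_two_pow_poly (c k : ℕ) (ha : ∀ d, a d ≤ 2 ^ (c * (d + 1) ^ k)) :
    DoubleExpBound a 0 :=
  .of_tendsto (fun d => by rw [Real.rpow_natCast]; exact_mod_cast ha d)
    (by simpa using tendsto_mul_succ_pow_div_two_pow c k)

lemma DoubleExpBound.mul (ha : DoubleExpBound a A) (hb : DoubleExpBound b B) :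
    DoubleExpBound (fun d => a d * b d) (A + B) := fun C' hC' => by
  filter_upwards [ha (A + (C' - (A + B)) / 2) (by linarith),
    hb (B + (C' - (A + B)) / 2) (by linarith)] with d had hbd
  calc ((a d * b d : ℕ) : ℝ) = a d * b d := Nat.cast_mul _ _
    _ ≤ _ := mul_le_mul had hbd (by positivity) (by positivity)
    _ = _ := by rw [← Real.rpow_add two_pos]; ring_nf

lemma DoubleExpBound.add (ha : DoubleExpBound a C) (hb : DoubleExpBound b C) :
    DoubleExpBound (fun d => a d + b d) C := fun C' hC' => by
  have htwo : DoubleExpBound (fun _ => 2) 0 := .of_le_two_pow_poly 1 0 fun _ => by norm_num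
  have hmax : DoubleExpBound (fun d => max (a d) (b d)) C := fun C' hC' => by
    filter_upwards [ha C' hC', hb C' hC'] with d had hbd
    exact (Nat.cast_max _ _).trans_le (max_le had hbd)
  refine ((htwo.mul hmax).mono (zero_add C).le fun d => ?_) C' hC'
  lia

lemma DoubleExpBound.of_succ (ha : DoubleExpBound (fun d => a (d + 1)) (2 * C)) :
    DoubleExpBound a C := fun C' hC' => by
  rw [← map_add_atTop_eq_nat 1, eventually_map]
  filter_upwards [ha (2 * C') (by linarith)] with d hd
  rwa [pow_succ', ← mul_assoc, mul_comm C' 2]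

end Asymptotics

section LatinCount

lemma sum_fin_le_of_geometric {n T : ℕ} {A B r : ℝ} (hA : 0 ≤ A) (hB : 0 ≤ B) (hr0 : 0 ≤ r)
    (hr1 : r < 1) {g : Fin n → ℝ} (hhead : ∀ t : Fin n, (t : ℕ) < T → g t ≤ A)
    (htail : ∀ t : Fin n, g t ≤ B * r ^ (t : ℕ)) :
    ∑ t, g t ≤ T * A + B * (r ^ T / (1 - r)) := by
  have hle : ∑ t, g t ≤ ∑ t : Fin n, if (t : ℕ) < T then A else B * r ^ (t : ℕ) :=
    Finset.sum_le_sum fun t _ => by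
      split_ifs with ht
      exacts [hhead t ht, htail t]
  rw [Fin.sum_univ_eq_sum_range (fun t => if t < T then A else B * r ^ t), Finset.sum_ite,
    Finset.sum_const, nsmul_eq_mul, ← Finset.mul_sum] at hle
  have hcard : (((Finset.range n).filter (· < T)).card : ℝ) ≤ T := by
    rw [Nat.cast_le]
    exact (Finset.card_le_card fun t ht => Finset.mem_range.2 (Finset.mem_filter.1 ht).2).trans_eq
      (Finset.card_range T)
  have hgeom : ∑ t ∈ (Finset.range n).filter (¬· < T), r ^ t ≤ r ^ T / (1 - r) := by
    refine le_trans (le_of_eq ?_) (geom_sum_Ico_le_of_lt_one (m := T) (n := n) hr0 hr1)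
    refine Finset.sum_congr ?_ fun _ _ => rfl
    ext t
    simp only [Finset.mem_filter, Finset.mem_range, Finset.mem_Ico, not_lt, and_comm]
  exact hle.trans (add_le_add (mul_le_mul_of_nonneg_right hcard hA)
    (mul_le_mul_of_nonneg_left hgeom hB))

variable {s : ℕ}

/-- Bound for the mean total loss of a bad Latin hypercube, relative to `2 ^ d`. -/
noncomputable def meanLoss (s T : ℕ) : ℝ := T / (2 * s) + 3 * (5 / 6) ^ T

lemma meanLoss_nonneg (s T : ℕ) : 0 ≤ meanLoss s T := by
  unfold meanLoss
  positivity

lemma IsBad.exists_sum_stageLoss_le {d T : ℕ} (hs : s ≠ 0) {f : Word (d + 1) → Fin 4}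
    (hf : IsLatin f) (hbad : IsBad s T (d + 1) f) :
    ∃ Q : Fin (d + 1) → Pair, ∑ t, stageLoss f Q t ≤ ⌊meanLoss s T * 2 ^ (d + 1)⌋₊ := by
  have : (0 : ℝ) < s := by positivity
  have hQ : Fintype.card (Fin (d + 1) → Pair) = 6 ^ (d + 1) := by
    rw [Fintype.card_fun, Fintype.card_fin, show Fintype.card Pair = 6 by decide]
  have hhead : ∀ t : Fin (d + 1), (t : ℕ) < T →
      ∑ Q, (stageLoss f Q t : ℝ) ≤ 6 ^ (d + 1) * (2 ^ (d + 1) / (2 * s)) := fun t ht => by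
    refine (Finset.sum_le_card_nsmul _ _ ((2 : ℝ) ^ (d + 1) / (2 * s)) fun Q _ => ?_).trans_eq ?_
    · rw [le_div_iff₀ (by positivity), mul_comm, mul_assoc]
      exact_mod_cast hbad.stageLoss_le Q ht
    · rw [Finset.card_univ, hQ, nsmul_eq_mul, Nat.cast_pow, Nat.cast_ofNat]
  have htail : ∀ t : Fin (d + 1),
      ∑ Q, (stageLoss f Q t : ℝ) ≤ 6 ^ (d + 1) * 2 ^ d * (5 / 6) ^ (t : ℕ) := fun t => by
    rw [div_pow, mul_div_assoc', le_div_iff₀ (by positivity)]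
    exact_mod_cast sum_stageLoss_le hf t
  have htotal : ∑ Q, ∑ t, (stageLoss f Q t : ℝ) ≤
      ∑ _Q : Fin (d + 1) → Pair, meanLoss s T * 2 ^ (d + 1) := by
    rw [Finset.sum_comm, Finset.sum_const, Finset.card_univ, hQ, nsmul_eq_mul, meanLoss]
    refine (sum_fin_le_of_geometric (by positivity) (by positivity) (by norm_num) (by norm_num)
      hhead htail).trans_eq ?_
    push_cast
    ring
  have : Nonempty (Fin (d + 1) → Pair) := ⟨fun _ => ⟨{0, 1}, rfl⟩⟩
  obtain ⟨Q, -, hQ⟩ := Finset.exists_le_of_sum_le Finset.univ_nonempty htotal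
  exact ⟨Q, Nat.le_floor (by exact_mod_cast hQ)⟩

lemma ncard_bad_le (hs : s ≠ 0) (T d : ℕ) : {f ∈ latinSet (d + 1) | IsBad s T (d + 1) f}.ncard ≤
    6 ^ (d + 1) * ((⌊meanLoss s T * 2 ^ (d + 1)⌋₊ + 1) ^ (d + 1) *
      (2 ^ ⌊meanLoss s T * 2 ^ (d + 1)⌋₊ * cubeColoringCount (d + 1))) := by
  have hsub : {f ∈ latinSet (d + 1) | IsBad s T (d + 1) f} ⊆ ⋃ Q : Fin (d + 1) → Pair,
      {f ∈ latinSet (d + 1) | ∑ t, stageLoss f Q t ≤ ⌊meanLoss s T * 2 ^ (d + 1)⌋₊} :=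
    fun f ⟨hf, hbad⟩ =>
      have ⟨Q, hQ⟩ := hbad.exists_sum_stageLoss_le hs hf
      Set.mem_iUnion.2 ⟨Q, hf, hQ⟩
  refine (Set.ncard_le_ncard hsub (Set.toFinite _)).trans
    ((Set.ncard_iUnion_le_of_fintype _).trans ?_)
  refine (Finset.sum_le_card_nsmul _ _ _ fun Q _ => ncard_sum_stageLoss_le Q _).trans_eq ?_
  rw [Finset.card_univ, Fintype.card_fun, Fintype.card_fin, show Fintype.card Pair = 6 by decide,
    smul_eq_mul]

lemma doubleExpBound_cubeColoringCount : DoubleExpBound cubeColoringCount 1 := by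
  refine .of_succ (.of_tendsto cubeColoringCount_succ_le_rpow ?_)
  have h := (tendsto_one_div_add_atTop_nhds_zero_nat (𝕜 := ℝ)).const_mul 4 |>.const_add 2
  rw [mul_zero, add_zero] at h
  rw [mul_one]
  refine h.congr fun d => ?_
  field_simp
  ring

lemma doubleExpBound_floor_add_one_pow {x : ℝ} (hx : 0 ≤ x) :
    DoubleExpBound (fun d => (⌊x * 2 ^ d⌋₊ + 1) ^ d) 0 := by
  obtain ⟨K, hK⟩ := pow_unbounded_of_one_lt (x + 1) one_lt_two
  refine .of_le_two_pow_poly (K + 1) 2 fun d => ?_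
  have hfloor : ⌊x * 2 ^ d⌋₊ + 1 ≤ 2 ^ (K + d) := by
    have hd : (1 : ℝ) ≤ 2 ^ d := one_le_pow₀ one_le_two
    have : (⌊x * 2 ^ d⌋₊ : ℝ) + 1 ≤ 2 ^ (K + d) :=
      calc _ ≤ x * 2 ^ d + 1 := by gcongr; exact Nat.floor_le (by positivity)
        _ ≤ (x + 1) * 2 ^ d := by linarith
        _ ≤ 2 ^ (K + d) := by rw [pow_add]; gcongr
    exact_mod_cast this
  calc _ ≤ (2 ^ (K + d)) ^ d := Nat.pow_le_pow_left hfloor d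
    _ = 2 ^ ((K + d) * d) := (pow_mul _ _ _).symm
    _ ≤ 2 ^ ((K + 1) * (d + 1) ^ 2) := Nat.pow_le_pow_right two_pos
        (by nlinarith [Nat.zero_le (K * d ^ 2), Nat.zero_le (K * d)])

lemma doubleExpBound_bad (hs : s ≠ 0) (T : ℕ) :
    DoubleExpBound (fun d => {f ∈ latinSet d | IsBad s T d f}.ncard) (1 + meanLoss s T) := by
  have hx := meanLoss_nonneg s T
  have hsix : DoubleExpBound (fun d => 6 ^ d) 0 := .of_le_two_pow_poly 3 1 fun d =>
    calc 6 ^ d ≤ (2 ^ 3) ^ d := Nat.pow_le_pow_left (by norm_num) d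
      _ = 2 ^ (3 * d) := (pow_mul _ _ _).symm
      _ ≤ _ := Nat.pow_le_pow_right two_pos (by lia)
  have hloss : DoubleExpBound (fun d => 2 ^ ⌊meanLoss s T * 2 ^ d⌋₊) (meanLoss s T) :=
    .two_pow fun d => Nat.floor_le (by positivity)
  refine (hsix.mul ((doubleExpBound_floor_add_one_pow hx).mul
    (hloss.mul doubleExpBound_cubeColoringCount))).mono (by linarith) fun d => ncard_bad_le hs T d

lemma doubleExpBound_notBadCount_succ (hs : s ≠ 0) (T : ℕ) {A C : ℝ} (hA : 2 ≤ A + C + 1 / s)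
    (hT : DoubleExpBound (notBadCount s T) A)
    (hC : DoubleExpBound (fun d => (latinSet d).ncard) C) :
    DoubleExpBound (notBadCount s (T + 1)) ((A + C + 1 / s) / 2) := by
  have hconst : ∀ c ≤ 8, DoubleExpBound (fun _ => c) 0 := fun c hc =>
    .of_le_two_pow_poly 3 0 fun _ => by simpa using hc
  have hsparse : DoubleExpBound (fun d => (2 ^ (9 * (d + 1)) ^ (2 * s)) ^ 4) 0 :=
    .of_le_two_pow_poly (9 ^ (2 * s) * 4) (2 * s) fun d => by
      rw [← pow_mul, mul_pow, mul_right_comm]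
  have hcube : DoubleExpBound (fun d => 2 ^ 2 ^ (d + 1)) 2 := .two_pow fun d => by
    rw [Nat.cast_pow, pow_succ', Nat.cast_ofNat]
  have hcomp : DoubleExpBound (fun d => 2 ^ (2 ^ d / s)) (1 / s) := .two_pow fun d => by
    rw [one_div_mul_eq_div]
    exact_mod_cast Nat.cast_div_le (α := ℝ) (m := 2 ^ d) (n := s)
  have hnice : DoubleExpBound
      (fun d => 6 * (2 ^ 2 ^ (d + 1) * (2 ^ (9 * (d + 1)) ^ (2 * s)) ^ 4)) (A + C + 1 / s) :=
    ((hconst 6 (by norm_num)).mul (hcube.mul hsparse)).mono (by linarith) fun _ => le_rfl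
  have hlayer : DoubleExpBound
      (fun d => 4 * (notBadCount s T d * (latinSet d).ncard * 2 ^ (2 ^ d / s))) (A + C + 1 / s) :=
    ((hconst 4 (by norm_num)).mul ((hT.mul hC).mul hcomp)).mono (by linarith) fun _ => le_rfl
  refine .of_succ ?_
  rw [mul_div_cancel₀ _ two_ne_zero]
  exact (hnice.add hlayer).mono le_rfl fun d => notBadCount_succ_le hs T (d + 1)

lemma doubleExpBound_notBadCount (hs : s ≠ 0) (T : ℕ) {C : ℝ} (hC₁ : 1 ≤ C)
    (hC : DoubleExpBound (fun d => (latinSet d).ncard) C) :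
    DoubleExpBound (notBadCount s T) (C - (C - 1) / 2 ^ T + 2 / s) := by
  have hs' : (0 : ℝ) < 1 / s := by positivity
  have htwo : (2 : ℝ) / s = 2 * (1 / s) := by ring
  rw [htwo]
  induction T with
  | zero =>
    refine .of_tendsto (e := fun d => (1 + 2 * (1 / s)) * 2 ^ d) (fun d => ?_) ?_
    · rw [notBadCount_zero, Nat.cast_zero]
      positivity
    · simp
  | succ T ih =>
    have hpow : (C - 1) / 2 ^ T ≤ C - 1 :=
      div_le_self (by linarith) (one_le_pow₀ one_le_two)
    have hhalf : (C - 1) / 2 ^ (T + 1) = (C - 1) / 2 ^ T / 2 := by rw [pow_succ, div_div]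
    refine (doubleExpBound_notBadCount_succ hs T (by linarith) ih hC).mono ?_ fun _ => le_rfl
    linarith

lemma DoubleExpBound.latin_step (hs : s ≠ 0) (T : ℕ) {C C' : ℝ} (hC₁ : 1 ≤ C)
    (hC : DoubleExpBound (fun d => (latinSet d).ncard) C) (hbad : 1 + meanLoss s T ≤ C')
    (hnotBad : C - (C - 1) / 2 ^ T + 2 / s ≤ C') :
    DoubleExpBound (fun d => (latinSet d).ncard) C' := by
  have hsplit : ∀ d, (latinSet d).ncard ≤
      {f ∈ latinSet d | IsBad s T d f}.ncard + notBadCount s T d := fun d =>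
    (Set.ncard_le_ncard (fun f hf => (em (IsBad s T d f)).imp (⟨hf, ·⟩) (⟨hf, ·⟩))
      (Set.toFinite _)).trans (Set.ncard_union_le _ _)
  have hbad' : DoubleExpBound (fun d => {f ∈ latinSet d | IsBad s T d f}.ncard) C' :=
    (doubleExpBound_bad hs T).mono hbad fun _ => le_rfl
  have hnotBad' : DoubleExpBound (notBadCount s T) C' :=
    (doubleExpBound_notBadCount hs T hC₁ hC).mono hnotBad fun _ => le_rfl
  exact (hbad'.add hnotBad').mono le_rfl fun d => hsplit (d + 1)

/-- Choose `T` first and then `s`: the loss becomes negligible while the gain `(C - 1) / 2 ^ T`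
stays fixed. -/
lemma DoubleExpBound.exists_latin_lt {C : ℝ} (hC₁ : 1 < C)
    (hC : DoubleExpBound (fun d => (latinSet d).ncard) C) :
    ∃ C' < C, 1 ≤ C' ∧ DoubleExpBound (fun d => (latinSet d).ncard) C' := by
  obtain ⟨T, hT⟩ : ∃ T : ℕ, (5 / 6 : ℝ) ^ T < (C - 1) / 6 :=
    exists_pow_lt_of_lt_one (by linarith) (by norm_num)
  have hgain : 0 < (C - 1) / 2 ^ T := div_pos (by linarith) (by positivity)
  have hloss : ∀ x : ℝ, ∀ ε > 0, ∀ᶠ s : ℕ in atTop, x / s < ε := fun x ε hε =>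
    (tendsto_const_div_atTop_nhds_zero_nat x).eventually_lt_const hε
  obtain ⟨s, hs₁, hs₂, hs₀⟩ := ((hloss (T / 2) ((C - 1) / 2) (by linarith)).and
    ((hloss 2 _ hgain).and (eventually_ne_atTop 0))).exists
  have hmean : meanLoss s T < C - 1 := by
    rw [meanLoss, ← div_div]
    linarith
  refine ⟨max (1 + meanLoss s T) (C - (C - 1) / 2 ^ T + 2 / s), max_lt ?_ ?_, le_max_of_le_left ?_,
    hC.latin_step hs₀ T hC₁.le (le_max_left _ _) (le_max_right _ _)⟩
  · linarith
  · linarith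
  · linarith [meanLoss_nonneg s T]

theorem doubleExpBound_latinSet : DoubleExpBound (fun d => (latinSet d).ncard) 1 := by
  let S : Set ℝ := {C | 1 ≤ C ∧ DoubleExpBound (fun d => (latinSet d).ncard) C}
  have hbdd : BddBelow S := ⟨1, fun C hC => hC.1⟩
  have hne : S.Nonempty := by
    refine ⟨1 + meanLoss 1 0, by linarith [meanLoss_nonneg 1 0],
      (doubleExpBound_bad one_ne_zero 0).mono le_rfl fun d => ?_⟩
    simp [IsBad]
  have hinf : DoubleExpBound (fun d => (latinSet d).ncard) (sInf S) := fun C' hC' => by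
    obtain ⟨C, hCS, hC⟩ := exists_lt_of_csInf_lt hne hC'
    exact hCS.2 C' hC
  obtain hlt | heq := (le_csInf hne fun C hC => hC.1).lt_or_eq
  · obtain ⟨C, hC, hCS⟩ := hinf.exists_latin_lt hlt
    exact absurd (csInf_le hbdd hCS) hC.not_ge
  · rwa [heq]

end LatinCount

section Shrikhande

/-- The vertices of the Shrikhande graph. -/
abbrev ShVertex : Type := ZMod 4 × ZMod 4

/-- The `ℤ₄`-indexed family with the given four terms; it makes statements about all such families
decidable by running through four bits. -/
def ofBits (a b c d : Bool) : ZMod 4 → Bool := ![a, b, c, d]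

lemma forall_ofBits {P : (ZMod 4 → Bool) → Prop} :
    (∀ a b c d, P (ofBits a b c d)) ↔ ∀ g, P g := by
  refine ⟨fun h g => ?_, fun h _ _ _ _ => h _⟩
  have hg : g = ofBits (g 0) (g 1) (g 2) (g 3) := by
    funext a
    fin_cases a <;> rfl
  exact hg ▸ h _ _ _ _

instance {P : (ZMod 4 → Bool) → Prop} [DecidablePred P] : Decidable (∀ g, P g) :=
  decidable_of_iff _ forall_ofBits

instance decidableEqShColoring : DecidableEq (ShVertex → Bool) := fun G G' =>
  decidable_of_iff (∀ v, G v = G' v) funext_iff.symm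

lemma shrikhande_adj_iff (v w : ShVertex) : shrikhande.Adj v w ↔
    v - w ∈ ({(1, 0), (0, 1), (1, 1), (-1, 0), (0, -1), (-1, -1)} : Finset ShVertex) := by
  simp only [shrikhande, SimpleGraph.circulantGraph, SimpleGraph.fromRel_adj,
    Set.mem_insert_iff, Set.mem_singleton_iff]
  revert v w
  decide +kernel

instance : DecidableRel shrikhande.Adj := fun v w =>
  decidable_of_iff _ (shrikhande_adj_iff v w).symm

/-- The residue modulo two of an element of `ℤ₄`. -/
def parity (a : ZMod 4) : Bool := a.val.bodd

/-- An automorphism of the Shrikhande graph of order six, which permutes its three directions. -/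
def shRotation : ShVertex ≃+ ShVertex where
  toFun v := (v.1 - v.2, v.1)
  invFun v := (v.2, v.2 - v.1)
  left_inv v := by simp
  right_inv v := by simp
  map_add' v w := by ext <;> simp; abel

/-- Automorphisms carrying the first direction of the Shrikhande graph to each of the three. -/
def shTurn : Fin 3 → (ShVertex ≃+ ShVertex) := ![.refl _, shRotation, shRotation.trans shRotation]

lemma shrikhande_adj_shTurn_symm : ∀ k v w, shrikhande.Adj v w →
    shrikhande.Adj ((shTurn k).symm v) ((shTurn k).symm w) := by
  decide +kernel

/-- The independent set with two vertices of the same parity in each of two opposite rows: `α` is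
the parity of the rows, and `β` and `γ` say which vertices are taken from the first and from the
second of them. -/
def rowCode (α β γ : Bool) (v : ShVertex) : Bool :=
  parity v.1 == α && xor (parity v.2) (if v.1.val < 2 then β else γ)

/-- An independent set with four vertices. -/
def IsShCode (J : ShVertex → Bool) : Prop :=
  (∀ v w, shrikhande.Adj v w → J v = true → J w = false) ∧ ∑ v, (J v).toNat = 4

/-- The Shrikhande graph has no edges inside the subset `g` of a row, inside the subset `h` of the
next row, or between the two. -/
def RowsIndep (g h : ZMod 4 → Bool) : Prop :=
  ∀ b, (g b = true → g (b + 1) = false ∧ h b = false ∧ h (b + 1) = false) ∧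
    (h b = true → h (b + 1) = false)

instance (g h : ZMod 4 → Bool) : Decidable (RowsIndep g h) :=
  inferInstanceAs (Decidable (∀ _, _))

lemma rowsIndep_of_indep {J : ShVertex → Bool}
    (hJ : ∀ v w, shrikhande.Adj v w → J v = true → J w = false) (a : ZMod 4) :
    RowsIndep (fun b => J (a, b)) fun b => J (a + 1, b) := by
  have hadj : ∀ a b : ZMod 4, shrikhande.Adj (a, b) (a, b + 1) ∧
      shrikhande.Adj (a, b) (a + 1, b) ∧ shrikhande.Adj (a, b) (a + 1, b + 1) := by decide +kernel
  exact fun b => ⟨fun h => ⟨hJ _ _ (hadj a b).1 h, hJ _ _ (hadj a b).2.1 h,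
    hJ _ _ (hadj a b).2.2 h⟩, hJ _ _ (hadj (a + 1) b).1⟩

lemma sum_shVertex (J : ShVertex → Bool) : ∑ v, (J v).toNat =
    ∑ b, (J (0, b)).toNat + ∑ b, (J (1, b)).toNat +
      (∑ b, (J (2, b)).toNat + ∑ b, (J (3, b)).toNat) := by
  rw [Fintype.sum_prod_type, ← add_assoc]
  exact Fin.sum_univ_four _

lemma RowsIndep.sum_le : ∀ {g h}, RowsIndep g h → ∑ b, (g b).toNat + ∑ b, (h b).toNat ≤ 2 := by
  decide +kernel

lemma sum_le_four_of_indep {J : ShVertex → Bool}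
    (hJ : ∀ v w, shrikhande.Adj v w → J v = true → J w = false) : ∑ v, (J v).toNat ≤ 4 := by
  rw [sum_shVertex]
  exact add_le_add (rowsIndep_of_indep hJ 0).sum_le (rowsIndep_of_indep hJ 2).sum_le

set_option synthInstance.maxSize 2000 in
lemma RowsIndep.exists_eq_rowCode : ∀ {g₀ g₁}, RowsIndep g₀ g₁ → ∀ {g₂}, RowsIndep g₁ g₂ →
    ∀ {g₃}, RowsIndep g₂ g₃ → RowsIndep g₃ g₀ →
    ∑ b, (g₀ b).toNat + ∑ b, (g₁ b).toNat + (∑ b, (g₂ b).toNat + ∑ b, (g₃ b).toNat) = 4 →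
    ∃ k α β γ, ∀ b, g₀ b = rowCode α β γ (shTurn k (0, b)) ∧
      g₁ b = rowCode α β γ (shTurn k (1, b)) ∧ g₂ b = rowCode α β γ (shTurn k (2, b)) ∧
      g₃ b = rowCode α β γ (shTurn k (3, b)) := by
  decide +kernel

lemma IsShCode.exists_eq_rowCode {J : ShVertex → Bool} (hJ : IsShCode J) :
    ∃ k α β γ, J = rowCode α β γ ∘ shTurn k := by
  have h := rowsIndep_of_indep hJ.1
  obtain ⟨k, α, β, γ, hJ⟩ := RowsIndep.exists_eq_rowCode (h 0) (h 1) (h 2) (h 3)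
    ((sum_shVertex J).symm.trans hJ.2)
  refine ⟨k, α, β, γ, funext fun ⟨a, b⟩ => ?_⟩
  fin_cases a
  exacts [(hJ b).1, (hJ b).2.1, (hJ b).2.2.1, (hJ b).2.2.2]

lemma IsShCode.comp_shTurn_symm {J : ShVertex → Bool} (hJ : IsShCode J) (k : Fin 3) :
    IsShCode (J ∘ (shTurn k).symm) :=
  ⟨fun _ _ h => hJ.1 _ _ (shrikhande_adj_shTurn_symm k _ _ h),
    ((shTurn k).symm.toEquiv.sum_comp fun v => (J v).toNat).trans hJ.2⟩

end Shrikhande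

section Stripes

/-- The colouring that alternates along every row, which in the row `a` starts with the colour
`g a`; here the rows are taken in the direction `k`. -/
def stripes (k : Fin 3) (g : ZMod 4 → Bool) (v : ShVertex) : Bool :=
  xor (parity (shTurn k v).2) (g (shTurn k v).1)

/-- A colouring that is the indicator of the union of two disjoint independent sets with four
vertices. -/
def IsShBalanced (G : ShVertex → Bool) : Prop := ∃ k g, G = stripes k g

lemma exists_eq_stripes : ∀ k α β γ l δ ε ζ,
    (∀ v, rowCode α β γ (shTurn k v) = true → rowCode δ ε ζ (shTurn l v) = false) →
    ∃ j a b c d, (fun v => rowCode α β γ (shTurn k v) || rowCode δ ε ζ (shTurn l v)) =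
      stripes j (ofBits a b c d) := by
  decide +kernel

lemma IsShCode.isShBalanced_or {J J' : ShVertex → Bool} (hJ : IsShCode J) (hJ' : IsShCode J')
    (hdis : ∀ v, J v = true → J' v = false) : IsShBalanced fun v => J v || J' v := by
  obtain ⟨k, α, β, γ, rfl⟩ := hJ.exists_eq_rowCode
  obtain ⟨l, δ, ε, ζ, rfl⟩ := hJ'.exists_eq_rowCode
  obtain ⟨j, a, b, c, d, h⟩ := exists_eq_stripes k α β γ l δ ε ζ hdis
  exact ⟨j, _, h⟩

/-- The neighbour of `v` in the next row (in the direction `k`) that has the same colour in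
`stripes k g`. -/
def zigzagStep (k : Fin 3) (g : ZMod 4 → Bool) (v : ShVertex) : ShVertex :=
  v + (shTurn k).symm (1, if g (shTurn k v).1 = g ((shTurn k v).1 + 1) then 0 else 1)

/-- The monochromatic cycle of `stripes k g` through `v`; its length is four or eight, so that eight
steps close it in either case. -/
def zigzag (k : Fin 3) (g : ZMod 4 → Bool) (v : ShVertex) (i : Fin 8) : ShVertex :=
  (zigzagStep k g)^[i] v

lemma adj_zigzagStep : ∀ k g v, shrikhande.Adj v (zigzagStep k g v) := by
  decide +kernel

lemma stripes_zigzagStep : ∀ k g v, stripes k g (zigzagStep k g v) = stripes k g v := by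
  decide +kernel

lemma isPeriodicPt_zigzagStep : ∀ k g v, IsPeriodicPt (zigzagStep k g) 8 v := by
  unfold IsPeriodicPt IsFixedPt
  decide +kernel

variable {k : Fin 3} {g : ZMod 4 → Bool} {K : Set ShVertex} {v w : ShVertex}

lemma zigzag_zigzag (k g v) (i j : Fin 8) :
    zigzag k g (zigzag k g v i) j = zigzag k g v (j + i) := by
  rw [zigzag, zigzag, zigzag, ← iterate_add_apply, Fin.val_add,
    (isPeriodicPt_zigzagStep k g v).iterate_mod_apply]

lemma ColorClosed.zigzag_mem (hK : ColorClosed shrikhande (stripes k g) K) (hv : v ∈ K)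
    (i : Fin 8) : zigzag k g v i ∈ K :=
  (show Set.MapsTo (zigzagStep k g) K K from fun w hw => hK w hw _ (adj_zigzagStep k g w)
    (stripes_zigzagStep k g w)).iterate i hv

lemma exists_stripes_add (k : Fin 3) (g : ZMod 4 → Bool) (v : ShVertex) :
    ∃ h, ∀ w, stripes k g (v + w) = stripes k h w := by
  have hparity : ∀ a b, parity (a + b) = xor (parity a) (parity b) := by decide
  refine ⟨fun a => xor (parity (shTurn k v).2) (g ((shTurn k v).1 + a)), fun w => ?_⟩
  simp only [stripes, map_add, Prod.fst_add, Prod.snd_add, hparity]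
  rw [Bool.xor_assoc, Bool.xor_left_comm]

lemma exists_zigzag_eq_add (k : Fin 3) (g : ZMod 4 → Bool) (v : ShVertex) :
    ∃ h, h 0 = false ∧ ∀ i, zigzag k g v i = v + zigzag k h 0 i := by
  set h : ZMod 4 → Bool := fun a => xor (g ((shTurn k v).1 + a)) (g (shTurn k v).1)
  have hstep : Semiconj (v + ·) (zigzagStep k h) (zigzagStep k g) := fun w => by
    simp [zigzagStep, h, add_assoc]
  refine ⟨h, by simp [h], fun i => ?_⟩
  have := (hstep.iterate_right i).eq 0
  rw [add_zero] at this
  exact this.symm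

lemma stripes_eq_of_const_zigzag : ∀ k h, h 0 = false → ∀ l g u,
    (∀ i, stripes l g (zigzag k h 0 i) = u) → ∀ l' g', (∀ i, stripes l' g' (zigzag k h 0 i) = u) →
    stripes l g = stripes l' g' := by
  decide +kernel

/-- The two colourings agree along the closed walk. -/
def AgreeAlong (G G' : ShVertex → Bool) (γ : Fin 8 → ShVertex) : Prop := ∀ i, G (γ i) = G' (γ i)

instance (G G' : ShVertex → Bool) (γ : Fin 8 → ShVertex) : Decidable (AgreeAlong G G' γ) :=
  inferInstanceAs (Decidable (∀ _, _))

set_option synthInstance.maxSize 2000 in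
lemma exists_zigzag_eq_of_agreeAlong : ∀ k g l h, stripes k g 0 = stripes l h 0 →
    stripes k g ≠ stripes l h →
    ∀ k' g', g' 0 = false → AgreeAlong (stripes k g) (stripes l h) (zigzag k' g' 0) →
    ∀ k'' g'', g'' 0 = false → AgreeAlong (stripes k g) (stripes l h) (zigzag k'' g'' 0) →
    ∀ i, ∃ j, zigzag k' g' 0 i = zigzag k'' g'' 0 j := by
  decide +kernel

/-- A monochromatic cycle through `v` of some balanced colouring. -/
def IsZigzagThrough (v : ShVertex) (C : Set ShVertex) : Prop := ∃ k g, C = Set.range (zigzag k g v)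

variable {C C' : Set ShVertex} {G G' : ShVertex → Bool}

lemma IsZigzagThrough.mem (hC : IsZigzagThrough v C) : v ∈ C := by
  obtain ⟨k, g, rfl⟩ := hC
  exact ⟨0, rfl⟩

lemma IsZigzagThrough.of_mem (hC : IsZigzagThrough v C) (hw : w ∈ C) : IsZigzagThrough w C := by
  obtain ⟨k, g, rfl⟩ := hC
  obtain ⟨i, rfl⟩ := hw
  refine ⟨k, g, ?_⟩
  simp only [funext (zigzag_zigzag k g v i)]
  exact ((Equiv.addRight i).surjective.range_comp _).symm

lemma IsShBalanced.exists_zigzag_subset (hG : IsShBalanced G) (hK : ColorClosed shrikhande G K)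
    (hv : v ∈ K) : ∃ C, IsZigzagThrough v C ∧ C ⊆ K := by
  obtain ⟨k, g, rfl⟩ := hG
  exact ⟨_, ⟨k, g, rfl⟩, Set.range_subset_iff.2 (hK.zigzag_mem hv)⟩

lemma IsShBalanced.translate (hG : IsShBalanced G) (v : ShVertex) :
    IsShBalanced fun w => G (v + w) := by
  obtain ⟨k, g, rfl⟩ := hG
  obtain ⟨h, hh⟩ := exists_stripes_add k g v
  exact ⟨k, h, funext hh⟩

lemma eq_of_translate_eq (h : (fun w => G (v + w)) = fun w => G' (v + w)) : G = G' :=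
  (Equiv.addLeft v).surjective.injective_comp_right h

lemma IsShBalanced.eq_of_const (hG : IsShBalanced G) (hG' : IsShBalanced G')
    (hC : IsZigzagThrough v C) {u : Bool} (h : ∀ w ∈ C, G w = u) (h' : ∀ w ∈ C, G' w = u) :
    G = G' := by
  obtain ⟨l, g, rfl⟩ := hC
  obtain ⟨h₀, hh₀, hzig⟩ := exists_zigzag_eq_add l g v
  obtain ⟨k, s, hs⟩ := hG.translate v
  obtain ⟨k', s', hs'⟩ := hG'.translate v
  refine eq_of_translate_eq (v := v) ?_
  rw [hs, hs']
  refine stripes_eq_of_const_zigzag l h₀ hh₀ k s u (fun i => ?_) k' s' fun i => ?_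
  · exact (congrFun hs _).symm.trans (h _ ⟨i, hzig i⟩)
  · exact (congrFun hs' _).symm.trans (h' _ ⟨i, hzig i⟩)

lemma IsShBalanced.eq_of_eqOn_of_not_subset (hG : IsShBalanced G) (hG' : IsShBalanced G')
    (hC : IsZigzagThrough v C) (hC' : IsZigzagThrough v C') (hCC' : ¬ C ⊆ C')
    (h : Set.EqOn G G' C) (h' : Set.EqOn G G' C') : G = G' := by
  have hv : G v = G' v := h hC.mem
  obtain ⟨l, g, rfl⟩ := hC
  obtain ⟨l', g', rfl⟩ := hC'
  obtain ⟨h₀, hh₀, hzig⟩ := exists_zigzag_eq_add l g v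
  obtain ⟨h₁, hh₁, hzig'⟩ := exists_zigzag_eq_add l' g' v
  obtain ⟨k, s, hs⟩ := hG.translate v
  obtain ⟨k', s', hs'⟩ := hG'.translate v
  refine eq_of_translate_eq (v := v) ?_
  rw [hs, hs']
  by_contra hne
  refine hCC' (Set.range_subset_iff.2 fun i => ?_)
  obtain ⟨j, hj⟩ := exists_zigzag_eq_of_agreeAlong k s k' s' (by simpa [← hs, ← hs'] using hv) hne
    l h₀ hh₀ (fun i => by rw [← hs, ← hs']; exact h ⟨i, hzig i⟩)
    l' h₁ hh₁ (fun i => by rw [← hs, ← hs']; exact h' ⟨i, hzig' i⟩) i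
  exact ⟨j, by rw [hzig, hzig', hj]⟩

end Stripes

section ShPropagation

variable {X Y : Type*} {G : SimpleGraph Y} {H : SimpleGraph X} {𝒞 : Set (X → Bool)}

lemma Propagates.of_monochromatic
    (h : ∀ φ ∈ 𝒞, ∀ φ' ∈ 𝒞, ∀ K : Set X, K.Nonempty → ColorClosed H φ K → ColorClosed H φ' K →
      ∀ u, (∀ x ∈ K, φ x = u) → (∀ x ∈ K, φ' x = u) → φ = φ') : Propagates H 𝒞 := by
  intro φ hφ φ' hφ' K ⟨z, hz⟩ hK hK' heq
  have hφ'z : ∀ x ∈ K, φ x = φ z → φ' x = φ z := fun x hx h => (heq hx).symm.trans h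
  refine h φ hφ φ' hφ' {x | x ∈ K ∧ φ x = φ z} ⟨z, hz, rfl⟩ (fun x hx y hxy hy => ?_)
    (fun x hx y hxy hy => ?_) (φ z) (fun x hx => hx.2) fun x hx => hφ'z x hx.1 hx.2
  · exact ⟨hK x hx.1 y hxy hy, hy.trans hx.2⟩
  · have hyK := hK' x hx.1 y hxy hy
    exact ⟨hyK, (heq hyK).trans (hy.trans (hφ'z x hx.1 hx.2))⟩

variable {φ φ' : Y × X → Bool} {K : Set (Y × X)}

lemma ColorClosed.fibre (hK : ColorClosed (G.boxProd H) φ K) (x : X) :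
    ColorClosed G (fun v => φ (v, x)) {v | (v, x) ∈ K} :=
  hK.comap (G.boxProdLeft H x).toHom

lemma ColorClosed.slice (hK : ColorClosed (G.boxProd H) φ K) (v : Y) :
    ColorClosed H (fun x => φ (v, x)) {x | (v, x) ∈ K} :=
  hK.comap (G.boxProdRight H v).toHom

lemma Propagates.slice_eq (h𝒞 : Propagates H 𝒞) (hφ : ∀ v, (fun x => φ (v, x)) ∈ 𝒞)
    (hφ' : ∀ v, (fun x => φ' (v, x)) ∈ 𝒞) (hK : ColorClosed (G.boxProd H) φ K)
    (hK' : ColorClosed (G.boxProd H) φ' K) {u : Bool} (hu : ∀ z ∈ K, φ z = u)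
    (hu' : ∀ z ∈ K, φ' z = u) {v w : Y} (hvw : ∀ x, (v, x) ∈ K ↔ (w, x) ∈ K) {x₀ : X}
    (hx₀ : (v, x₀) ∈ K) (x : X) :
    φ (v, x) = φ' (w, x) := by
  have hset : {x | (v, x) ∈ K} = {x | (w, x) ∈ K} := Set.ext hvw
  exact congrFun (h𝒞 _ (hφ v) _ (hφ' w) _ ⟨x₀, hx₀⟩ (hK.slice v) (hset ▸ hK'.slice w)
    fun x hx => (hu _ hx).trans (hu' _ ((hvw x).1 hx)).symm) x

/-- The two-colourings of a product with the Shrikhande graph that belong to `𝒞` on all copies of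
the other factor and are balanced on all copies of the Shrikhande graph. -/
def shExtension (𝒞 : Set (X → Bool)) : Set (ShVertex × X → Bool) :=
  {φ | (∀ v, (fun x => φ (v, x)) ∈ 𝒞) ∧ ∀ x, IsShBalanced fun v => φ (v, x)}

/- All closed sets contain a copy of a monochromatic cycle `C`. If `K` has the same slice over all
points of `C`, then both colourings are constant on all copies of `C`; otherwise `K` contains a copy
of a second cycle through a point of `C`, and the colourings agree on all copies of both. -/
lemma Propagates.shExtension (h𝒞 : Propagates H 𝒞) :
    Propagates (shrikhande.boxProd H) (shExtension 𝒞) := by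
  refine .of_monochromatic fun φ hφ φ' hφ' K ⟨⟨v₀, x₀⟩, hz⟩ hK hK' u hu hu' => ?_
  have hcycle : ∀ {v x}, (v, x) ∈ K → ∃ C, IsZigzagThrough v C ∧ ∀ w ∈ C, (w, x) ∈ K :=
    fun {v x} h => (hφ.2 x).exists_zigzag_subset (hK.fibre x) h
  suffices hfibre : ∀ x, (fun v => φ (v, x)) = fun v => φ' (v, x) from
    funext fun z => congrFun (hfibre z.2) z.1
  intro x
  obtain ⟨C, hC, hCK⟩ := hcycle hz
  by_cases hcase : ∀ v ∈ C, ∀ w ∈ C, ∀ y, (v, y) ∈ K → (w, y) ∈ K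
  · have hslice : ∀ w ∈ C, ∀ y, (w, y) ∈ K ↔ (v₀, y) ∈ K := fun w hw y =>
      ⟨hcase w hw v₀ hC.mem y, hcase v₀ hC.mem w hw y⟩
    exact (hφ.2 x).eq_of_const (hφ'.2 x) hC (u := φ (v₀, x))
      (fun w hw => h𝒞.slice_eq hφ.1 hφ.1 hK hK hu hu (hslice w hw) (hCK w hw) x)
      fun w hw => h𝒞.slice_eq hφ'.1 hφ.1 hK' hK hu' hu (hslice w hw) (hCK w hw) x
  · push Not at hcase
    obtain ⟨v, hv, w, hw, y, hvy, hwy⟩ := hcase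
    obtain ⟨C', hC', hCK'⟩ := hcycle hvy
    exact (hφ.2 x).eq_of_eqOn_of_not_subset (hφ'.2 x) (hC.of_mem hv) hC'
      (fun hsub => hwy (hCK' w (hsub hw)))
      (fun t ht => h𝒞.slice_eq hφ.1 hφ'.1 hK hK' hu hu' (fun _ => .rfl) (hCK t ht) x)
      fun t ht => h𝒞.slice_eq hφ.1 hφ'.1 hK hK' hu hu' (fun _ => .rfl) (hCK' t ht) x

end ShPropagation

section DoobPropagation

variable {m n : ℕ}

/-- The two-colourings of the Doob graph that are balanced on the Shrikhande fibres and on the lines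
over the complete factors. -/
def doobBalanced (m n : ℕ) : Set (DoobVertex m n → Bool) :=
  {φ | (∀ (p : DoobVertex m n) i, IsShBalanced fun v => φ (update p.1 i v, p.2)) ∧
    ∀ (p : DoobVertex m n) j, IsBalancedLine fun c => φ (p.1, update p.2 j c)}

lemma doobGraph_adj_iff {p q : DoobVertex m n} : (doobGraph m n).Adj p q ↔
    (∃ i v, shrikhande.Adj (p.1 i) v ∧ q = (update p.1 i v, p.2)) ∨
      ∃ j c, p.2 j ≠ c ∧ q = (p.1, update p.2 j c) := by
  rw [doobGraph, SimpleGraph.boxProd_adj, cartesianPower_adj_iff, cartesianPower_adj_iff]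
  constructor
  · rintro (⟨⟨i, v, hv, h⟩, h'⟩ | ⟨⟨j, c, hc, h⟩, h'⟩)
    exacts [.inl ⟨i, v, hv, Prod.ext h h'.symm⟩, .inr ⟨j, c, hc, Prod.ext h'.symm h⟩]
  · rintro (⟨i, v, hv, rfl⟩ | ⟨j, c, hc, rfl⟩)
    exacts [.inl ⟨⟨i, v, hv, rfl⟩, rfl⟩, .inr ⟨⟨j, c, hc, rfl⟩, rfl⟩]

/-- The insertion of a Shrikhande coordinate at position `i`. -/
def insertVertex (i : Fin (m + 1)) (z : ShVertex × DoobVertex m n) : DoobVertex (m + 1) n :=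
  (i.insertNth (α := fun _ => ShVertex) z.1 z.2.1, z.2.2)

lemma insertVertex_update_left (i : Fin (m + 1)) (v w : ShVertex) (p : DoobVertex m n) (k : Fin m) :
    insertVertex i (v, (update p.1 k w, p.2)) =
      (update (insertVertex i (v, p)).1 (i.succAbove k) w, (insertVertex i (v, p)).2) := by
  simp [insertVertex]

lemma update_insertVertex (i : Fin (m + 1)) (v w : ShVertex) (p : DoobVertex m n) :
    (update (insertVertex i (v, p)).1 i w, (insertVertex i (v, p)).2) = insertVertex i (w, p) := by
  simp [insertVertex]

lemma insertVertex_removeNth (i : Fin (m + 1)) (v : ShVertex) (p : DoobVertex (m + 1) n) :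
    insertVertex i (v, (i.removeNth p.1, p.2)) = (update p.1 i v, p.2) := by
  simp [insertVertex]

lemma insertVertex_surjective (i : Fin (m + 1)) : Surjective (insertVertex (n := n) i) := fun p =>
  ⟨_, (insertVertex_removeNth i (p.1 i) p).trans (by rw [update_eq_self])⟩

lemma doobGraph_adj_insertVertex (i : Fin (m + 1)) {z z' : ShVertex × DoobVertex m n}
    (h : (shrikhande.boxProd (doobGraph m n)).Adj z z') :
    (doobGraph (m + 1) n).Adj (insertVertex i z) (insertVertex i z') := by
  obtain ⟨v, p⟩ := z
  obtain ⟨w, q⟩ := z'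
  rw [SimpleGraph.boxProd_adj] at h
  rw [doobGraph_adj_iff]
  obtain ⟨h, rfl⟩ | ⟨h, rfl⟩ := h
  · exact .inl ⟨i, w, by simpa [insertVertex] using h, (update_insertVertex i v w p).symm⟩
  obtain ⟨k, w, hw, rfl⟩ | ⟨j, c, hc, rfl⟩ := doobGraph_adj_iff.1 h
  · exact .inl ⟨i.succAbove k, w, by simpa [insertVertex] using hw,
      insertVertex_update_left i v w p k⟩
  · exact .inr ⟨j, c, hc, rfl⟩

lemma comp_insertVertex_mem {φ : DoobVertex (m + 1) n → Bool} (hφ : φ ∈ doobBalanced (m + 1) n)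
    (i : Fin (m + 1)) : φ ∘ insertVertex i ∈ shExtension (doobBalanced m n) := by
  refine ⟨fun v => ⟨fun p k => ?_, fun p j => hφ.2 (insertVertex i (v, p)) j⟩, fun p => ?_⟩
  · simpa only [comp_apply, insertVertex_update_left] using
      hφ.1 (insertVertex i (v, p)) (i.succAbove k)
  · simpa only [comp_apply, update_insertVertex] using hφ.1 (insertVertex i (0, p)) i

theorem propagates_doobBalanced (m n : ℕ) : Propagates (doobGraph m n) (doobBalanced m n) := by
  induction m with
  | zero =>
    exact (propagates_balancedFunctions n).of_surjective
      (SimpleGraph.boxProdRight (cartesianPower shrikhande 0) _ ![]).toHom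
      (fun p => ⟨p.2, Prod.ext (Subsingleton.elim _ _) rfl⟩)
      fun φ hφ y j => hφ.2 (![], y) j
  | succ m ih =>
    exact ih.shExtension.of_surjective ⟨insertVertex 0, doobGraph_adj_insertVertex 0⟩
      (insertVertex_surjective 0) fun φ hφ => comp_insertVertex_mem hφ 0

end DoobPropagation

section DoobCode

variable {m n : ℕ}

/-- A set, given by its indicator, that has four independent vertices on every Shrikhande fibre and
one point on every line over a complete factor. -/
def IsDoobCode (M : DoobVertex m n → Bool) : Prop :=
  (∀ (p : DoobVertex m n) i, IsShCode fun v => M (update p.1 i v, p.2)) ∧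
    ∀ (p : DoobVertex m n) j, ∃! c, M (p.1, update p.2 j c) = true

/-- A proper colouring of the Shrikhande graph by four colours. -/
def shColoring : shrikhande.Coloring (ZMod 4) :=
  .mk (fun v => 2 * v.1 + (v.2.val % 2 : ℕ)) fun {v w} => by
    revert v w
    decide +kernel

/-- A proper colouring of the complete graph by four colours. -/
def completeColoring : (⊤ : SimpleGraph (Fin 4)).Coloring (ZMod 4) :=
  .mk (fun c => (c.val : ZMod 4)) fun {c e} => by
    revert c e
    decide

lemma sum_update_ne_sum {ι α β : Type*} [Fintype ι] [DecidableEq ι] [AddCommGroup β] (f : α → β)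
    {x : ι → α} {i : ι} {a : α} (h : f (x i) ≠ f a) :
    ∑ k, f (x k) ≠ ∑ k, f (update x i a k) := by
  simp only [apply_update (fun _ => f), Finset.sum_update_of_mem (Finset.mem_univ i)]
  rw [← Finset.add_sum_erase _ _ (Finset.mem_univ i), Finset.sdiff_singleton_eq_erase]
  exact fun h' => h (add_right_cancel h')

/-- A proper colouring of the Doob graph by four colours: the sum of the colours of the
coordinates. -/
def doobColoring (m n : ℕ) : (doobGraph m n).Coloring (ZMod 4) :=
  .mk (fun p => ∑ i, shColoring (p.1 i) + ∑ j, completeColoring (p.2 j)) fun {p q} h => by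
    obtain ⟨i, v, hv, rfl⟩ | ⟨j, c, hc, rfl⟩ := doobGraph_adj_iff.1 h
    · exact fun h => sum_update_ne_sum shColoring (shColoring.valid hv) (add_right_cancel h)
    · exact fun h => sum_update_ne_sum completeColoring (completeColoring.valid hc)
        (add_left_cancel h)

lemma exists_large_indepSet (m n : ℕ) : ∃ t : Finset (DoobVertex m n),
    (doobGraph m n).IsIndepSet t ∧ Fintype.card (DoobVertex m n) ≤ 4 * t.card := by
  obtain ⟨y, -, hy⟩ := Finset.exists_le_of_sum_le (s := Finset.univ)
    (f := fun _ : ZMod 4 => Fintype.card (DoobVertex m n))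
    (g := fun y => 4 * (Finset.univ.filter fun p => doobColoring m n p = y).card)
    Finset.univ_nonempty <| by
      rw [← Finset.mul_sum, ← Finset.card_eq_sum_card_fiberwise (fun _ _ => Finset.mem_univ _)]
      simp
  refine ⟨_, fun p hp q hq _ h => (doobColoring m n).valid h ?_, hy⟩
  rw [(Finset.mem_filter_univ p).1 hp, (Finset.mem_filter_univ q).1 hq]

section DoubleCounting

variable {X A : Type*} [Fintype X] [Fintype A] {u : X → A → X} {r : X → A}

lemma sum_sum_fibre (hu : ∀ x a, u (u x a) (r x) = x) (hr : ∀ x a, r (u x a) = a) (F : X → ℕ) :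
    ∑ x, ∑ a, F (u x a) = Fintype.card A * ∑ x, F x := by
  have hinv : Involutive fun z : X × A => (u z.1 z.2, r z.1) := fun z =>
    Prod.ext (hu z.1 z.2) (hr z.1 z.2)
  calc ∑ x, ∑ a, F (u x a) = ∑ z : X × A, F (u z.1 z.2) :=
      (Fintype.sum_prod_type fun z : X × A => F (u z.1 z.2)).symm
    _ = ∑ z : X × A, F z.1 := hinv.bijective.sum_comp fun z : X × A => F z.1
    _ = Fintype.card A * ∑ x, F x := by
      simp only [Fintype.sum_prod_type_right, Finset.sum_const, smul_eq_mul, Finset.card_univ]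

lemma sum_fibre_eq (hu : ∀ x a, u (u x a) (r x) = x) (hr : ∀ x a, r (u x a) = a) {F : X → ℕ} {k : ℕ}
    (hle : ∀ x, ∑ a, F (u x a) ≤ k) (hF : k * Fintype.card X ≤ Fintype.card A * ∑ x, F x) (x : X) :
    ∑ a, F (u x a) = k := by
  refine (Finset.sum_eq_sum_iff_of_le fun x _ => hle x).1 ?_ x (Finset.mem_univ x)
  refine le_antisymm (Finset.sum_le_sum fun x _ => hle x) ?_
  rwa [sum_sum_fibre hu hr, Finset.sum_const, smul_eq_mul, Finset.card_univ, mul_comm]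

end DoubleCounting

lemma card_le_of_mem_MDS {M : Finset (DoobVertex m n)} (hM : M ∈ MDS m n) :
    Fintype.card (DoobVertex m n) ≤ 4 * ∑ p, (decide (p ∈ M)).toNat := by
  obtain ⟨t, ht, htcard⟩ := exists_large_indepSet m n
  have hsum : ∑ p, (decide (p ∈ M)).toNat = M.card := by
    simp [Bool.toNat, Bool.cond_decide]
  rw [hsum]
  exact htcard.trans (Nat.mul_le_mul_left _ (hM.maximum t ht))

lemma sum_le_one_of_indep : ∀ {κ : Fin 4 → Bool}, (∀ c e, c ≠ e → κ c = true → κ e = false) →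
    ∑ c, (κ c).toNat ≤ 1 := by
  decide

lemma existsUnique_of_sum_eq_one : ∀ {κ : Fin 4 → Bool}, ∑ c, (κ c).toNat = 1 →
    ∃! c, κ c = true := by
  unfold ExistsUnique
  decide

/- The Shrikhande fibres contain at most four vertices of a code, the lines over the complete
factors at most one, and a code of maximum size must attain these bounds on average. -/
lemma isDoobCode_of_mem_MDS {M : Finset (DoobVertex m n)} (hM : M ∈ MDS m n) :
    IsDoobCode fun p => decide (p ∈ M) := by
  have hcard := card_le_of_mem_MDS hM
  have hindep : ∀ p q, (doobGraph m n).Adj p q → decide (p ∈ M) = true →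
      decide (q ∈ M) = false := fun p q h hp =>
    decide_eq_false fun hq => hM.isIndepSet (of_decide_eq_true hp) hq h.ne h
  refine ⟨fun p i => ?_, fun p j => ?_⟩
  · have hfibre : ∀ p : DoobVertex m n, ∀ v w, shrikhande.Adj v w →
        decide ((update p.1 i v, p.2) ∈ M) = true → decide ((update p.1 i w, p.2) ∈ M) = false :=
      fun p v w h => hindep _ _ (doobGraph_adj_iff.2 (.inl ⟨i, w, by simpa using h, by simp⟩))
    refine ⟨hfibre p, sum_fibre_eq (u := fun (p : DoobVertex m n) v => (update p.1 i v, p.2))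
      (r := fun p => p.1 i) (by simp) (by simp) (F := fun p => (decide (p ∈ M)).toNat)
      (fun p => sum_le_four_of_indep (hfibre p)) ?_ p⟩
    rw [show Fintype.card ShVertex = 16 from rfl]
    omega
  · have hline : ∀ p : DoobVertex m n, ∀ c e, c ≠ e →
        decide ((p.1, update p.2 j c) ∈ M) = true → decide ((p.1, update p.2 j e) ∈ M) = false :=
      fun p c e h => hindep _ _ (doobGraph_adj_iff.2 (.inr ⟨j, e, by simpa using h, by simp⟩))
    refine existsUnique_of_sum_eq_one (sum_fibre_eq
      (u := fun (p : DoobVertex m n) c => (p.1, update p.2 j c)) (r := fun p => p.2 j) (by simp)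
      (by simp) (F := fun p => (decide (p ∈ M)).toNat)
      (fun p => sum_le_one_of_indep (hline p)) ?_ p)
    rw [Fintype.card_fin]
    omega

end DoobCode

section RowCode

/-- An independent set with four vertices that lie in two opposite rows. -/
def IsRowCode (J : ShVertex → Bool) : Prop := ∃ α β γ, J = rowCode α β γ

/-- The row codes that take vertices of different parities from their two rows; they are contained
in no other pair of opposite lines, whatever the direction. -/
def skewCode (α β : Bool) : ShVertex → Bool := rowCode α β !β

variable {J : ShVertex → Bool}

lemma rowCode_comp_shTurn : ∀ k α β, ∃ γ δ, rowCode α β β ∘ shTurn k = rowCode γ δ δ := by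
  decide +kernel

lemma IsShCode.isRowCode_or (hJ : IsShCode J) :
    IsRowCode J ∨ ∃ k α β, J ∘ (shTurn k).symm = skewCode α β := by
  obtain ⟨k, α, β, γ, rfl⟩ := hJ.exists_eq_rowCode
  obtain rfl | rfl := Bool.eq_or_eq_not γ β
  · obtain ⟨δ, ε, h⟩ := rowCode_comp_shTurn k α γ
    exact .inl ⟨δ, ε, ε, h⟩
  · exact .inr ⟨k, α, β, funext fun v => by simp [skewCode]⟩

/-- One of the two rows that meet `skewCode α β`. -/
def skewRow (α : Bool) : ZMod 4 := α.toNat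

lemma skewCode_skewRow : ∀ α β,
    (skewCode α β (skewRow α, 0) || skewCode α β (skewRow α, 1)) = true ∧
    (skewCode α β (skewRow α, 2) || skewCode α β (skewRow α, 3)) = true := by
  decide

lemma rowCode_comp_shTurn_eq_skewCode : ∀ k α β γ δ ε b,
    (∀ v, skewCode δ ε v = true → rowCode α β γ (shTurn k v) = false) →
    rowCode α β γ (shTurn k (skewRow δ, b)) = true →
    rowCode α β γ ∘ shTurn k = skewCode δ !ε := by
  decide +kernel

lemma IsShCode.eq_skewCode (hJ : IsShCode J) {α β : Bool}
    (hdis : ∀ v, skewCode α β v = true → J v = false) {b : ZMod 4}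
    (hb : J (skewRow α, b) = true) : J = skewCode α !β := by
  obtain ⟨k, γ, δ, ε, rfl⟩ := hJ.exists_eq_rowCode
  exact rowCode_comp_shTurn_eq_skewCode k γ δ ε α β b hdis hb

lemma exists_eq_rowCode_of_skewRow : ∀ k α β γ δ,
    (rowCode α β γ (shTurn k (skewRow δ, 0)) || rowCode α β γ (shTurn k (skewRow δ, 1))) =
      (rowCode α β γ (shTurn k (skewRow δ, 2)) || rowCode α β γ (shTurn k (skewRow δ, 3))) →
    ∃ α' β' γ', rowCode α β γ ∘ shTurn k = rowCode α' β' γ' := by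
  decide +kernel

lemma IsShCode.isRowCode_of_skewRow (hJ : IsShCode J) {α : Bool}
    (h : (J (skewRow α, 0) || J (skewRow α, 1)) = (J (skewRow α, 2) || J (skewRow α, 3))) :
    IsRowCode J := by
  obtain ⟨k, β, γ, δ, rfl⟩ := hJ.exists_eq_rowCode
  exact exists_eq_rowCode_of_skewRow k β γ δ α h

lemma rowCode_add_two : ∀ α β γ v, rowCode α β γ (v.1, v.2 + 2) = rowCode α β γ v := by
  decide +kernel

lemma IsRowCode.add_two (hJ : IsRowCode J) (v : ShVertex) : J (v.1, v.2 + 2) = J v := by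
  obtain ⟨α, β, γ, rfl⟩ := hJ
  exact rowCode_add_two α β γ v

/-- An enumeration of the four vertices in the first two columns and in the first (`ε = false`) or
the last (`ε = true`) two rows. Every row code contains exactly one of the four, and those for
`ε = false` and for `ε = true` together determine it. -/
def quarterPoint (ε : Bool) (c : Fin 4) : ShVertex :=
  ((c.val / 2 + if ε then 2 else 0 : ℕ), (c.val % 2 : ℕ))

lemma existsUnique_rowCode_quarterPoint : ∀ α β γ ε, ∃! c,
    rowCode α β γ (quarterPoint ε c) = true := by
  unfold ExistsUnique
  decide +kernel

lemma IsRowCode.existsUnique_quarterPoint (hJ : IsRowCode J) (ε : Bool) :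
    ∃! c, J (quarterPoint ε c) = true := by
  obtain ⟨α, β, γ, rfl⟩ := hJ
  exact existsUnique_rowCode_quarterPoint α β γ ε

lemma exists_quarterPoint : ∀ v, ∃ ε c, quarterPoint ε c = v ∨
    quarterPoint ε c = (v.1, v.2 + 2) := by
  decide +kernel

end RowCode

section Turning

variable {m n : ℕ}

namespace IsDoobCode

lemma eq_false_of_adj {M : DoobVertex m n → Bool} (hM : IsDoobCode M) {p q : DoobVertex m n}
    (h : (doobGraph m n).Adj p q) (hp : M p = true) : M q = false := by
  obtain ⟨i, v, hv, rfl⟩ | ⟨j, c, hc, rfl⟩ := doobGraph_adj_iff.1 h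
  · exact (hM.1 p i).1 (p.1 i) v hv (by simpa using hp)
  · by_contra hq
    exact hc ((hM.2 p j).unique (by simpa using hp) (eq_true_of_ne_false hq))

lemma isShCode_insertVertex {M : DoobVertex (m + 1) n → Bool} (hM : IsDoobCode M)
    (i : Fin (m + 1)) (p : DoobVertex m n) : IsShCode fun v => M (insertVertex i (v, p)) := by
  simpa only [update_insertVertex] using hM.1 (insertVertex i (0, p)) i

lemma eq_skewCode_of_adj {M : DoobVertex (m + 1) n → Bool} (hM : IsDoobCode M) {i : Fin (m + 1)}
    {α β : Bool} {p q : DoobVertex m n} (hp : (fun v => M (insertVertex i (v, p))) = skewCode α β)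
    (hpq : (doobGraph m n).Adj p q) {b : ZMod 4}
    (hb : M (insertVertex i ((skewRow α, b), q)) = true) :
    (fun v => M (insertVertex i (v, q))) = skewCode α !β :=
  (hM.isShCode_insertVertex i q).eq_skewCode (fun v hv => hM.eq_false_of_adj
    (doobGraph_adj_insertVertex i (SimpleGraph.boxProd_adj_right.2 hpq))
    ((congrFun hp v).trans hv)) hb

end IsDoobCode

lemma isBalancedLine_or : ∀ {κ κ' : Fin 4 → Bool}, (∃! c, κ c = true) → (∃! c, κ' c = true) →
    (∀ c, κ c = true → κ' c = false) → IsBalancedLine fun c => κ c || κ' c := by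
  unfold ExistsUnique
  decide

/-- The union of the two layers `M (v, ·)` and `M (w, ·)` of a code, where `v` and `w` are values of
the `i`-th Shrikhande coordinate. -/
def layerUnion (M : DoobVertex (m + 1) n → Bool) (i : Fin (m + 1)) (v w : ShVertex)
    (p : DoobVertex m n) : Bool :=
  M (insertVertex i (v, p)) || M (insertVertex i (w, p))

namespace IsDoobCode

variable {M : DoobVertex (m + 1) n → Bool}

lemma layerUnion_mem (hM : IsDoobCode M) (i : Fin (m + 1)) {v w : ShVertex}
    (hvw : shrikhande.Adj v w) : layerUnion M i v w ∈ doobBalanced m n := by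
  have hdis : ∀ p, M (insertVertex i (v, p)) = true → M (insertVertex i (w, p)) = false :=
    fun p => (hM.isShCode_insertVertex i p).1 v w hvw
  have hfibre : ∀ u (p : DoobVertex m n) k,
      IsShCode fun x => M (insertVertex i (u, (update p.1 k x, p.2))) := fun u p k => by
    simpa only [insertVertex_update_left] using hM.1 (insertVertex i (u, p)) (i.succAbove k)
  exact ⟨fun p k => (hfibre v p k).isShBalanced_or (hfibre w p k) fun x => hdis _,
    fun p j => isBalancedLine_or (hM.2 (insertVertex i (v, p)) j) (hM.2 (insertVertex i (w, p)) j)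
      fun c => hdis _⟩

/- The union of the layers over the first two points of the row `skewRow α` and the union of the
layers over the last two are balanced, and they agree where the fibre is a skew code `skewCode α β`.
The set of these places is closed under steps along both colourings, so the two unions are equal,
which forces all fibres to be row codes. -/
lemma isRowCode_of_skewCode (hM : IsDoobCode M) (i : Fin (m + 1)) {α β : Bool}
    {p₀ : DoobVertex m n} (h₀ : (fun v => M (insertVertex i (v, p₀))) = skewCode α β)
    (p : DoobVertex m n) : IsRowCode fun v => M (insertVertex i (v, p)) := by
  have hadj : ∀ a : ZMod 4, shrikhande.Adj (a, 0) (a, 1) ∧ shrikhande.Adj (a, 2) (a, 3) := by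
    decide +kernel
  set K : Set (DoobVertex m n) := {p | ∃ β, (fun v => M (insertVertex i (v, p))) = skewCode α β}
  have hK : ∀ p ∈ K, layerUnion M i (skewRow α, 0) (skewRow α, 1) p = true ∧
      layerUnion M i (skewRow α, 2) (skewRow α, 3) p = true := by
    rintro p ⟨β, hβ⟩
    have h := skewCode_skewRow α β
    rwa [← hβ] at h
  have hstep : ∀ p ∈ K, ∀ q, (doobGraph m n).Adj p q → ∀ b c,
      layerUnion M i (skewRow α, b) (skewRow α, c) q = true → q ∈ K := by
    rintro p ⟨β, hβ⟩ q hpq b c h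
    obtain h | h := Bool.or_eq_true_iff.1 h <;> exact ⟨_, hM.eq_skewCode_of_adj hβ hpq h⟩
  have heq : layerUnion M i (skewRow α, 0) (skewRow α, 1) =
      layerUnion M i (skewRow α, 2) (skewRow α, 3) :=
    propagates_doobBalanced m n _ (hM.layerUnion_mem i (hadj _).1) _
      (hM.layerUnion_mem i (hadj _).2) K ⟨p₀, β, h₀⟩
      (fun p hp q hpq h => hstep p hp q hpq _ _ (h.trans (hK p hp).1))
      (fun p hp q hpq h => hstep p hp q hpq _ _ (h.trans (hK p hp).2))
      fun p hp => (hK p hp).1.trans (hK p hp).2.symm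
  exact (hM.isShCode_insertVertex i p).isRowCode_of_skewRow (congrFun heq p)

end IsDoobCode

/-- The automorphism of the Doob graph that turns the `i`-th Shrikhande coordinate by `τ i`. -/
def turnAll (n : ℕ) (τ : Fin m → Fin 3) : DoobVertex m n ≃ DoobVertex m n :=
  (Equiv.piCongrRight fun i => (shTurn (τ i)).symm.toEquiv).prodCongr (Equiv.refl _)

lemma turnAll_update (τ : Fin m → Fin 3) (p : DoobVertex m n) (i : Fin m) (v : ShVertex) :
    turnAll n τ (update p.1 i v, p.2) =
      (update (turnAll n τ p).1 i ((shTurn (τ i)).symm v), (turnAll n τ p).2) :=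
  Prod.ext (funext fun k => apply_update (fun i => (shTurn (τ i)).symm) p.1 i v k) rfl

lemma turnAll_insertVertex (τ : Fin (m + 1) → Fin 3) (i : Fin (m + 1)) (v : ShVertex)
    (p : DoobVertex m n) : turnAll n τ (insertVertex i (v, p)) =
      insertVertex i ((shTurn (τ i)).symm v, turnAll n (τ ∘ i.succAbove) p) := by
  refine Prod.ext ((Fin.eq_insertNth_iff).2 ⟨?_, funext fun k => ?_⟩) rfl
  · simp [turnAll, insertVertex]
  · simp [turnAll, insertVertex, Fin.removeNth]

namespace IsDoobCode

lemma comp_turnAll {M : DoobVertex m n → Bool} (hM : IsDoobCode M) (τ : Fin m → Fin 3) :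
    IsDoobCode (M ∘ turnAll n τ) := by
  refine ⟨fun p i => ?_, fun p j => hM.2 (turnAll n τ p) j⟩
  simp only [comp_apply, turnAll_update]
  exact (hM.1 (turnAll n τ p) i).comp_shTurn_symm (τ i)

lemma exists_turn_insertVertex {M : DoobVertex (m + 1) n → Bool} (hM : IsDoobCode M)
    (i : Fin (m + 1)) :
    ∃ k, ∀ p, IsRowCode fun v => M (insertVertex i ((shTurn k).symm v, p)) := by
  by_cases hskew : ∃ p k α β,
      (fun v => M (insertVertex i ((shTurn k).symm v, p))) = skewCode α β
  · obtain ⟨p₀, k, α, β, h⟩ := hskew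
    set e : DoobVertex m n ≃ DoobVertex m n := turnAll n fun _ => k
    have hturn : ∀ v p, turnAll n (fun _ => k) (insertVertex i (v, e.symm p)) =
        insertVertex i ((shTurn k).symm v, p) := fun v p =>
      (turnAll_insertVertex _ i v _).trans
        (congrArg (fun q => insertVertex i ((shTurn k).symm v, q)) (e.apply_symm_apply p))
    refine ⟨k, fun p => ?_⟩
    simpa only [comp_apply, hturn] using (hM.comp_turnAll fun _ => k).isRowCode_of_skewCode i
      (p₀ := e.symm p₀) (by simpa only [comp_apply, hturn] using h) (e.symm p)
  · refine ⟨0, fun p => (hM.isShCode_insertVertex i p).isRowCode_or.resolve_right ?_⟩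
    rintro ⟨k, α, β, h⟩
    exact hskew ⟨p, k, α, β, h⟩

lemma exists_turn {M : DoobVertex m n → Bool} (hM : IsDoobCode M) (i : Fin m) :
    ∃ k, ∀ p : DoobVertex m n, IsRowCode fun v => M (update p.1 i ((shTurn k).symm v), p.2) := by
  obtain _ | m := m
  · exact i.elim0
  obtain ⟨k, hk⟩ := hM.exists_turn_insertVertex i
  refine ⟨k, fun p => ?_⟩
  simpa only [insertVertex_removeNth] using hk (i.removeNth p.1, p.2)

end IsDoobCode

end Turning

section CodeCount

variable {m n : ℕ}

/-- The codes of the Doob graph all of whose Shrikhande fibres are row codes. -/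
def rowCodes (m n : ℕ) : Set (DoobVertex m n → Bool) :=
  {M | IsDoobCode M ∧ ∀ (p : DoobVertex m n) i, IsRowCode fun v => M (update p.1 i v, p.2)}

lemma ncard_MDS_le_ncard_isDoobCode (m n : ℕ) :
    (MDS m n).ncard ≤ {M : DoobVertex m n → Bool | IsDoobCode M}.ncard := by
  refine Set.ncard_le_ncard_of_injOn (fun M p => decide (p ∈ M))
    (fun M hM => isDoobCode_of_mem_MDS hM) (fun M _ M' _ h => ?_) (Set.toFinite _)
  ext p
  simpa using congrFun h p

lemma ncard_isDoobCode_le (m n : ℕ) :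
    {M : DoobVertex m n → Bool | IsDoobCode M}.ncard ≤ 3 ^ m * (rowCodes m n).ncard := by
  have hsub : {M : DoobVertex m n → Bool | IsDoobCode M} ⊆
      ⋃ τ : Fin m → Fin 3, {M | M ∘ turnAll n τ ∈ rowCodes m n} := fun M hM => by
    choose τ hτ using fun i => IsDoobCode.exists_turn hM i
    refine Set.mem_iUnion.2 ⟨τ, hM.comp_turnAll τ, fun p i => ?_⟩
    simpa only [comp_apply, turnAll_update] using hτ i (turnAll n τ p)
  calc _ ≤ (⋃ τ : Fin m → Fin 3, {M | M ∘ turnAll n τ ∈ rowCodes m n}).ncard :=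
        Set.ncard_le_ncard hsub
    _ ≤ ∑ τ : Fin m → Fin 3, {M | M ∘ turnAll n τ ∈ rowCodes m n}.ncard :=
        Set.ncard_iUnion_le_of_fintype _
    _ ≤ ∑ _τ : Fin m → Fin 3, (rowCodes m n).ncard :=
        Finset.sum_le_sum fun τ _ => Set.ncard_le_ncard_of_injOn (· ∘ turnAll n τ)
          (fun M hM => hM) ((turnAll n τ).surjective.injective_comp_right.injOn) (Set.toFinite _)
    _ = 3 ^ m * (rowCodes m n).ncard := by simp

/-- The MDS codes of the Hamming graph `H(d, 4)`: the sets of words meeting every line in exactly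
one word. -/
def lineCodes (d : ℕ) : Set (Word d → Bool) := {h | ∀ y i, ∃! c, h (update y i c) = true}

/-- The embedding of the words of length `m + n` into the Doob graph along which a row code is cut
into `2 ^ m` codes of the Hamming graph; `ε` numbers the pieces. -/
def quarterVertex (ε : Fin m → Bool) (y : Word (m + n)) : DoobVertex m n :=
  (fun i => quarterPoint (ε i) (y (Fin.castAdd n i)), fun j => y (Fin.natAdd m j))

lemma castAdd_ne_natAdd (i : Fin m) (j : Fin n) : Fin.castAdd n i ≠ Fin.natAdd m j :=
  Fin.ne_of_lt (i.2.trans_le (Nat.le_add_right m j))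

lemma quarterVertex_update_castAdd (ε : Fin m → Bool) (y : Word (m + n)) (i : Fin m) (c : Fin 4) :
    quarterVertex ε (update y (Fin.castAdd n i) c) =
      (update (quarterVertex ε y).1 i (quarterPoint (ε i) c), (quarterVertex ε y).2) := by
  refine Prod.ext (funext fun k => ?_) (funext fun j => ?_)
  · obtain rfl | hk := eq_or_ne k i
    · simp [quarterVertex]
    · simp [quarterVertex, hk]
  · exact update_of_ne (castAdd_ne_natAdd i j).symm _ _

lemma quarterVertex_update_natAdd (ε : Fin m → Bool) (y : Word (m + n)) (j : Fin n) (c : Fin 4) :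
    quarterVertex ε (update y (Fin.natAdd m j) c) =
      ((quarterVertex ε y).1, update (quarterVertex ε y).2 j c) := by
  refine Prod.ext (funext fun i => ?_) ?_
  · exact congrArg (quarterPoint (ε i)) (update_of_ne (castAdd_ne_natAdd i j) _ _)
  · exact update_comp_eq_of_injective y (Fin.natAdd_injective n m) j c

lemma comp_quarterVertex_mem {M : DoobVertex m n → Bool} (hM : M ∈ rowCodes m n)
    (ε : Fin m → Bool) : M ∘ quarterVertex ε ∈ lineCodes (m + n) := fun y => by
  refine Fin.addCases (fun i => ?_) fun j => ?_
  · simpa only [comp_apply, quarterVertex_update_castAdd] using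
      (hM.2 (quarterVertex ε y) i).existsUnique_quarterPoint (ε i)
  · simpa only [comp_apply, quarterVertex_update_natAdd] using hM.1.2 (quarterVertex ε y) j

lemma rowCodes_congr {M : DoobVertex m n → Bool} (hM : M ∈ rowCodes m n) (p : DoobVertex m n)
    {x : Fin m → ShVertex} (hx : ∀ i, x i = p.1 i ∨ x i = ((p.1 i).1, (p.1 i).2 + 2)) :
    M (x, p.2) = M p := by
  have hpiecewise : ∀ S : Finset (Fin m), M (S.piecewise x p.1, p.2) = M p := fun S => by
    induction S using Finset.induction_on with
    | empty => simp
    | insert i S hi ih =>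
      rw [← ih, Finset.piecewise_insert]
      have hpi : S.piecewise x p.1 i = p.1 i := Finset.piecewise_eq_of_notMem _ _ _ hi
      rcases hx i with h | h
      · rw [h, ← hpi, update_eq_self]
      · have := (hM.2 (S.piecewise x p.1, p.2) i).add_two (p.1 i)
        rw [h]
        exact this.trans (by simp only [← hpi, update_eq_self])
  simpa using hpiecewise Finset.univ

lemma exists_quarterVertex (p : DoobVertex m n) :
    ∃ ε y, ∀ M ∈ rowCodes m n, M (quarterVertex ε y) = M p := by
  choose ε c hεc using fun i => exists_quarterPoint (p.1 i)
  refine ⟨ε, Fin.append c p.2, fun M hM => ?_⟩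
  simpa only [quarterVertex, Fin.append_left, Fin.append_right] using rowCodes_congr hM p hεc

lemma ncard_rowCodes_le (m n : ℕ) :
    (rowCodes m n).ncard ≤ (lineCodes (m + n)).ncard ^ 2 ^ m := by
  have hinj : Injective fun (M : rowCodes m n) (ε : Fin m → Bool) =>
      (⟨M.1 ∘ quarterVertex ε, comp_quarterVertex_mem M.2 ε⟩ : lineCodes (m + n)) := by
    rintro ⟨M, hM⟩ ⟨M', hM'⟩ h
    refine Subtype.ext (funext fun p => ?_)
    obtain ⟨ε, y, hy⟩ := exists_quarterVertex p
    have hε : M ∘ quarterVertex ε = M' ∘ quarterVertex ε := Subtype.mk.inj (congrFun h ε)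
    exact (hy M hM).symm.trans ((congrFun hε y).trans (hy M' hM'))
  simpa [Nat.card_fun, Nat.card_coe_set_eq] using Nat.card_le_card_of_injective _ hinj

lemma ncard_lineCodes_succ_le (d : ℕ) : (lineCodes (d + 1)).ncard ≤ (latinSet d).ncard := by
  have hletter : ∀ h ∈ lineCodes (d + 1), ∀ y, ∃ a, ∀ c, h (prepend c y) = true ↔ c = a :=
    fun h hh y => by
      obtain ⟨a, ha, huniq⟩ := hh (prepend 0 y) 0
      simp only [Fin.update_cons_zero] at ha huniq
      exact ⟨a, fun c => ⟨huniq c, fun hc => hc ▸ ha⟩⟩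
  choose! f hf using hletter
  refine Set.ncard_le_ncard_of_injOn f (fun h hh x i a b hab => ?_) (fun h hh h' hh' heq => ?_)
    (Set.toFinite _)
  · refine (hh (prepend (f h (update x i a)) x) i.succ).unique ?_ ?_
    · simpa only [← Fin.cons_update] using (hf h hh _ _).2 rfl
    · simpa only [← Fin.cons_update] using (hf h hh _ _).2 hab
  · funext z
    obtain ⟨c, y, rfl⟩ := exists_prepend_eq z
    rw [Bool.eq_iff_iff, hf h hh, hf h' hh', heq]

theorem ncard_MDS_le {d : ℕ} (hd : m + n = d + 1) :
    (MDS m n).ncard ≤ 3 ^ m * (latinSet d).ncard ^ 2 ^ m := by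
  refine (ncard_MDS_le_ncard_isDoobCode m n).trans ((ncard_isDoobCode_le m n).trans
    (Nat.mul_le_mul_left _ ((ncard_rowCodes_le m n).trans (Nat.pow_le_pow_left ?_ _))))
  exact hd ▸ ncard_lineCodes_succ_le d

end CodeCount

section CodeAsymptotics

lemma ncard_MDS_le_rpow {m n d : ℕ} {η : ℝ} (hd : m + n = d + 1)
    (hlatin : ((latinSet d).ncard : ℝ) ≤ 2 ^ ((1 + η) * 2 ^ d)) :
    ((MDS m n).ncard : ℝ) ≤ 2 ^ (((2 * m + n : ℕ) : ℝ) + (1 + η) * 2 ^ (d + m)) := by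
  have hthree : (3 : ℝ) ^ m ≤ (2 : ℝ) ^ (2 * m + n) := calc
    (3 : ℝ) ^ m ≤ 4 ^ m := pow_le_pow_left₀ (by norm_num) (by norm_num) m
    _ = 2 ^ (2 * m) := by rw [pow_mul]; norm_num
    _ ≤ 2 ^ (2 * m + n) := pow_le_pow_right₀ one_le_two (Nat.le_add_right _ _)
  calc ((MDS m n).ncard : ℝ) ≤ 3 ^ m * ((latinSet d).ncard : ℝ) ^ 2 ^ m := by
        exact_mod_cast ncard_MDS_le hd
    _ ≤ 2 ^ (2 * m + n) * ((2 : ℝ) ^ ((1 + η) * 2 ^ d)) ^ 2 ^ m := by gcongr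
    _ = 2 ^ (((2 * m + n : ℕ) : ℝ) + (1 + η) * 2 ^ (d + m)) := by
        rw [← Real.rpow_mul_natCast zero_le_two, Nat.cast_pow, Nat.cast_ofNat, mul_assoc (1 + η),
          ← pow_add, Real.rpow_add two_pos, Real.rpow_natCast]

lemma eventually_ncard_MDS_le {η : ℝ} (hη : 0 < η) : ∀ᶠ N : ℕ in atTop, ∀ m n : ℕ, 2 * m + n = N →
    ((MDS m n).ncard : ℝ) ≤ 2 ^ ((2 : ℝ) ^ ((N : ℝ) - 1) * (1 + η)) := by
  obtain ⟨d₀, hd₀⟩ := eventually_atTop.1 (doubleExpBound_latinSet (1 + η / 2) (by linarith))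
  have hlinear : ∀ᶠ N : ℕ in atTop, (N : ℝ) ≤ η / 4 * 2 ^ N := by
    filter_upwards [(tendsto_mul_succ_pow_div_two_pow 1 1).eventually_le_const
      (show 0 < η / 4 by positivity)] with N hN
    rw [div_le_iff₀ (by positivity)] at hN
    linarith
  filter_upwards [eventually_ge_atTop (2 * d₀ + 2), hlinear] with N hN hlinear m n hmn
  obtain ⟨d, hd⟩ : ∃ d, m + n = d + 1 := ⟨m + n - 1, by omega⟩
  have hN' : N = d + m + 1 := by omega
  refine (ncard_MDS_le_rpow hd (hd₀ d (by omega))).trans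
    (Real.rpow_le_rpow_of_exponent_le one_le_two ?_)
  have hexp : (2 : ℝ) ^ ((N : ℝ) - 1) = 2 ^ (d + m) := by
    rw [← Real.rpow_natCast, hN', Nat.cast_succ, add_sub_cancel_right]
  have hpow : (2 : ℝ) ^ N = 2 * 2 ^ (d + m) := by rw [hN', pow_succ']
  rw [hmn, hexp]
  rw [hpow] at hlinear
  linarith

lemma ncard_MDS_pos (m n : ℕ) : 0 < (MDS m n).ncard :=
  (Set.ncard_pos (Set.toFinite _)).2 SimpleGraph.maximumIndepSet_exists

/-- The least `η ≥ 0` for which the number of MDS codes in `D(m, n)` is at most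
`2 ^ (2 ^ (2m + n - 1) (1 + η))`. -/
noncomputable def codeExcess (m n : ℕ) : ℝ :=
  max 0 (Real.logb 2 (MDS m n).ncard / (2 : ℝ) ^ (((2 * m + n : ℕ) : ℝ) - 1) - 1)

lemma codeExcess_le_iff {m n : ℕ} {η : ℝ} (hη : 0 ≤ η) : codeExcess m n ≤ η ↔
    ((MDS m n).ncard : ℝ) ≤ (2 : ℝ) ^ ((2 : ℝ) ^ (((2 * m + n : ℕ) : ℝ) - 1) * (1 + η)) := by
  have hpos : (0 : ℝ) < (MDS m n).ncard := by exact_mod_cast ncard_MDS_pos m n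
  rw [← Real.logb_le_iff_le_rpow one_lt_two hpos, codeExcess, max_le_iff, sub_le_iff_le_add,
    div_le_iff₀ (by positivity), mul_comm, add_comm η]
  exact and_iff_right hη

/-- The largest of the numbers `codeExcess m n` with `2m + n = N`. -/
noncomputable def maxCodeExcess (N : ℕ) : ℝ :=
  (Finset.range (N / 2 + 1)).sup' Finset.nonempty_range_add_one fun m => codeExcess m (N - 2 * m)

lemma codeExcess_le_maxCodeExcess (m n : ℕ) : codeExcess m n ≤ maxCodeExcess (2 * m + n) := by
  have hm : m ∈ Finset.range ((2 * m + n) / 2 + 1) := Finset.mem_range.2 (by omega)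
  simpa only [Nat.add_sub_cancel_left, maxCodeExcess] using
    Finset.le_sup' (fun k => codeExcess k (2 * m + n - 2 * k)) hm

lemma maxCodeExcess_nonneg (N : ℕ) : 0 ≤ maxCodeExcess N := by
  simpa using (le_max_left 0 _).trans (codeExcess_le_maxCodeExcess 0 N)

lemma tendsto_maxCodeExcess : Tendsto maxCodeExcess atTop (𝓝 0) := by
  refine tendsto_order.2 ⟨fun a ha => .of_forall fun N => ha.trans_le (maxCodeExcess_nonneg N),
    fun η hη => ?_⟩
  filter_upwards [eventually_ncard_MDS_le (half_pos hη)] with N hN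
  refine (Finset.sup'_le _ _ fun m hm => ?_).trans_lt (half_lt_self hη)
  have hmN : 2 * m + (N - 2 * m) = N := by
    have := Finset.mem_range.1 hm
    omega
  rw [codeExcess_le_iff (half_pos hη).le, hmN]
  exact hN m _ hmN

end CodeAsymptotics

theorem corollary2 :
    ∃ ε : ℕ → ℝ, Tendsto ε atTop (𝓝 0) ∧
      ∀ m n : ℕ, ((MDS m n).ncard : ℝ) ≤
        (2 : ℝ) ^ ((2 : ℝ) ^ (((2 * m + n : ℕ) : ℝ) - 1) * (1 + ε (2 * m + n))) :=
  ⟨maxCodeExcess, tendsto_maxCodeExcess, fun m n =>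
    (codeExcess_le_iff (maxCodeExcess_nonneg _)).1 (codeExcess_le_maxCodeExcess m n)⟩
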